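/- An alphabet is a finite non-empty set, and a class of languages $\mathcal C$ assigns to every alphabet $A$ a set $\mathcal C(A)$ of languages $L\subseteq A^*$. A positive variety is a class $\mathcal C$ of regular languages such that every $\mathcal C(A)$ contains $\emptyset$ and $A^*$, is closed under binary union and intersection and under the quotients $u^{-1}L=\{v: uv\in L\}$ and $Lu^{-1}=\{v: vu\in L\}$ for $u\in A^*$, and such that $\alpha^{-1}(L)\in\mathcal C(A)$ for all alphabets $A,B$, every monoid morphism $\alpha\colon A^*\to B^*$ and every $L\in\mathcal C(B)$. Let $\mathbf P$ be a finite partition of $A^*$ and let $[u]_{\mathbf P}$ be the block containing $u$. Put $\tau_{\mathbf P}(a_1\cdots a_n)=b_1\cdots b_n\in(\mathbf P\times A)^*$ with $b_i=([a_1\cdots a_{i-1}]_{\mathbf P},a_i)$. For classes $\mathcal C,\mathcal D$, the class $\mathcal C\circ\mathcal D$ consists, over each alphabet $A$, of the languages $\bigcup_{P\in\mathbf P}\bigl(\tau_{\mathbf P}^{-1}(L_P)\cap P\bigr)$, where $\mathbf P$ is a finite partition of $A^*$ into languages of $\mathcal D(A)$ and $L_P\in\mathcal C(\mathbf P\times A)$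 for every $P\in\mathbf P$. Let $\mathsf{SU}(A)$ be the set of finite Boolean combinations of languages $A^*w$ with $w\in A^*$, and $\mathsf{MOD}(A)$ the set of finite Boolean combinations of languages $\{w\in A^*: |w|\equiv m \bmod d\}$ with $0\le m<d$. The $\mathcal C$-covering problem takes as input an alphabet $A$, a regular language $L_1\subseteq A^*$ and a finite multiset $\mathbf L_2$ of regular languages over $A$ (regular languages being given by nondeterministic finite automata), and asks whether there is a finite set $\mathbf K\subseteq\mathcal C(A)$ such that $L_1\subseteq\bigcup_{K\in\mathbf K}K$ and every $K\in\mathbf K$ is disjoint from some $L\in\mathbf L_2$. The $\mathcal C$-separation problem takes as input an alphabet $A$ and two regular languages $L_1,L_2\subseteq A^*$ and asks whether there is $K\in\mathcal C(A)$ with $L_1\subseteq K$ and $K\cap L_2=\emptyset$. **Corollary.** Let $\mathcal C$ be a positive variety. The covering problem for $(\mathcal C\circ\mathsf{SU})\circ\mathsf{MOD}$ can be effectively reduced to the covering problem for $\mathcal C$, and the separation problem for $(\mathcal C\circ\mathsf{SU})\circ\mathsf{MOD}$ can be effectively reduced to the separation problem for $\mathcal C$. Here a problem effectively reduces to another one if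 there is a computable map $f$ from inputs of the first to inputs of the second such that $x$ is a positive instance of the first if and only if $f(x)$ is a positive instance of the second. -/

import Mathlib

namespace WordLang

/-- A class of languages: to every alphabet (a finite non-empty type of letters) it associates a set
of languages, a language over `A` being a set of words, i.e. of lists of letters. -/
abbrev LanguageClass : Type 1 :=
  ∀ (A : Type) [Finite A] [Nonempty A], Set (Set (List A))

/-- Positive varieties (of regular languages): lattices of regular languages which are closed under
left and right quotients by words and under inverse images of arbitrary monoid morphisms
`A* → B*` (possibly erasing). -/
structure IsPositiveVariety (C : LanguageClass) : Prop where
  regular : ∀ (A : Type) [Finite A] [Nonempty A], ∀ L ∈ C A, Language.IsRegular (T := A) L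
  empty_mem : ∀ (A : Type) [Finite A] [Nonempty A], ∅ ∈ C A
  univ_mem : ∀ (A : Type) [Finite A] [Nonempty A], Set.univ ∈ C A
  union_mem : ∀ (A : Type) [Finite A] [Nonempty A], ∀ L₁ ∈ C A, ∀ L₂ ∈ C A, L₁ ∪ L₂ ∈ C A
  inter_mem : ∀ (A : Type) [Finite A] [Nonempty A], ∀ L₁ ∈ C A, ∀ L₂ ∈ C A, L₁ ∩ L₂ ∈ C A
  left_quotient_mem : ∀ (A : Type) [Finite A] [Nonempty A], ∀ L ∈ C A, ∀ u : List A,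
    {v | u ++ v ∈ L} ∈ C A
  right_quotient_mem : ∀ (A : Type) [Finite A] [Nonempty A], ∀ L ∈ C A, ∀ u : List A,
    {v | v ++ u ∈ L} ∈ C A
  preimage_mem : ∀ (A B : Type) [Finite A] [Nonempty A] [Finite B] [Nonempty B]
    (φ : FreeMonoid A →* FreeMonoid B), ∀ L ∈ C B,
    {w : List A | (φ (FreeMonoid.ofList w)).toList ∈ L} ∈ C A

/-- A finite partition of `A*` (with non-empty blocks). -/
structure FinPartition (A : Type) where
  parts : Set (Set (List A))
  finite : parts.Finite
  isPartition : Setoid.IsPartition parts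

namespace FinPartition

variable {A : Type} (P : FinPartition A)

/-- The block of the partition that contains the word `u`. -/
noncomputable def block (u : List A) : P.parts :=
  ⟨(P.isPartition.2 u).choose, (P.isPartition.2 u).choose_spec.1.1⟩

theorem mem_block (u : List A) : u ∈ (P.block u : Set (List A)) :=
  (P.isPartition.2 u).choose_spec.1.2

instance : Finite P.parts := P.finite

instance : Nonempty P.parts := ⟨P.block []⟩

/-- The `P`-tagging of a word `a₁ ⋯ aₙ`: its `i`-th letter is the pair consisting of the block of
the prefix `a₁ ⋯ aᵢ₋₁` and of the letter `aᵢ`. (Positions are counted from `0` in the code.) -/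
noncomputable def tag (w : List A) : List (P.parts × A) :=
  w.mapIdx fun i a => (P.block (w.take i), a)

/-- `L` is `P`-liftable from `C`: it is the union over the blocks `p` of `P` of the sets
`τ_P⁻¹(F p) ∩ p`, for languages `F p` in `C` over the alphabet `P × A`. -/
def Liftable [Finite A] [Nonempty A] (C : LanguageClass) (L : Set (List A)) : Prop :=
  ∃ F : P.parts → Set (List (P.parts × A)),
    (∀ p, F p ∈ C (P.parts × A)) ∧ L = ⋃ p : P.parts, (P.tag ⁻¹' F p) ∩ p

end FinPartition

/-- The `D`-enrichment `C ∘ D` of `C`: the languages that are `P`-liftable from `C` for some finite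
partition `P` of `A*` into languages of `D`. -/
def enrich (C D : LanguageClass) : LanguageClass := fun A _ _ =>
  {L | ∃ P : FinPartition A, (∀ K ∈ P.parts, K ∈ D A) ∧ P.Liftable C L}

/-- Suffix languages: finite Boolean combinations of languages `A* w`. -/
def SU : LanguageClass := fun A _ _ =>
  BooleanSubalgebra.closure {L : Set (List A) | ∃ w : List A, L = {v | w <:+ v}}

/-- Modulo languages: finite Boolean combinations of languages `{v : |v| = m mod d}`, `m < d`. -/
def MOD : LanguageClass := fun A _ _ =>
  BooleanSubalgebra.closure
    {L : Set (List A) | ∃ m d : ℕ, m < d ∧ L = {v | v.length ≡ m [MOD d]}}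

section Problems

variable {A : Type} [Finite A] [Nonempty A]

/-- `L₁` is `C`-separable from `L₂`. -/
def Separable (C : LanguageClass) (L₁ L₂ : Set (List A)) : Prop :=
  ∃ K ∈ C A, L₁ ⊆ K ∧ L₂ ∩ K = ∅

/-- `(L₁, Ls)` is `C`-coverable: there is a finite set of languages of `C` that covers `L₁` and is
separating for the multiset `Ls` (each of its members is disjoint from some language in `Ls`). -/
def Coverable (C : LanguageClass) (L₁ : Set (List A)) (Ls : Multiset (Set (List A))) : Prop :=
  ∃ Ks : Set (Set (List A)), Ks.Finite ∧ (∀ K ∈ Ks, K ∈ C A) ∧ L₁ ⊆ ⋃₀ Ks ∧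
    ∀ K ∈ Ks, ∃ L ∈ Ls, K ∩ L = ∅

end Problems

/-- Finite descriptions of nondeterministic finite automata with states named by natural numbers:
the list of transitions (source, letter, target), the list of initial states and the list of final
states. -/
abbrev NFACode : Type := List (ℕ × ℕ × ℕ) × List ℕ × List ℕ

/-- The automaton with description `c` over the alphabet `Fin (k + 1)`. Only the finitely many
states that occur in `c` matter; transitions on a letter `> k` are ignored. -/
def NFACode.toNFA (k : ℕ) (c : NFACode) : NFA (Fin (k + 1)) ℕ where
  step q a := {r | (q, (a : ℕ), r) ∈ c.1}
  start := {q | q ∈ c.2.1}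
  accept := {q | q ∈ c.2.2}

/-- The regular language over `Fin (k + 1)` given by the description `c`. -/
def NFACode.language (k : ℕ) (c : NFACode) : Set (List (Fin (k + 1))) :=
  (c.toNFA k).accepts

/-- The `C`-separation problem. An input is a number `k`, which stands for the alphabet with
`k + 1` letters, together with two automata over it. -/
def SeparationProblem (C : LanguageClass) (x : ℕ × NFACode × NFACode) : Prop :=
  Separable C (x.2.1.language x.1) (x.2.2.language x.1)

/-- The `C`-covering problem. An input is a number `k`, which stands for the alphabet with
`k + 1` letters, together with an automaton over it and a finite list of automata over it. -/
def CoveringProblem (C : LanguageClass) (x : ℕ × NFACode × List NFACode) : Prop :=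
  Coverable C (x.2.1.language x.1)
    (Multiset.ofList (x.2.2.map fun c : NFACode => c.language x.1))

end WordLang

/-!
Write `K = (C ∘ SU) ∘ MOD`. A language of `K` is tested by a language of `C` on a tagged word, where
the tag of a position and the choice of the language of `C` only depend on the last `N` letters and
on the length modulo `d` of a prefix, i.e. on its class for `SufEq N d`; conversely such tests define
languages of `K`. These two facts, `exists_tagWith_of_mem_enrich` and `mem_enrich_SU_MOD`, are all
that is used about enrichments.

Let the input languages be recognised by a morphism to a finite monoid `M`, and let `Ω > 0` be such
that `X ^ Ω` is idempotent for every subset `X` of `M`. So every element of `M` has an idempotent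
`Ω`-th power, and the words of length `Ω j` take the same values for all `j ≥ 1`. A position of a
word is *stabilised* if it is a multiple of `Ω` and the value of a bounded window before it is fixed
by right multiplication with `ev f ^ Ω` for some word `f` of length `Ω`. This is visible to `K`, and
by the pigeonhole principle every long factor contains a stabilised position (`exists_stabilized`).
Cutting a word at its stabilised positions turns it into a word over a finite alphabet of letters
`(q, v, f)`, with value `v f^Ω`, followed by an end marker `(q, v)` that describes what comes after
the last cut. The reduction replaces each language by the set of words over this alphabet that
describe its words (`lift`).

* From `C` to `K`: the factorisation at stabilised positions is a transduction of the kind allowed in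
  `mem_enrich_SU_MOD`, so it pulls back languages of `C` to languages of `K`.
* From `K` to `C`: given `N` and `d`, a letter `(q, v, f)` can be expanded to a word with the same
  value, of length divisible by `d`, and ending with a power of `f` of length at least `N`. Then the
  tagging of an expanded word is a morphic image of the word of letters (`exists_transfer`).
* The languages of `C` obtained this way depend on the end marker. If `C` contains a non-trivial
  language, then `C` can test which marker ends a word (`IsPositiveVariety.exists_marker_test`) and
  the languages for the various markers can be combined. If all languages of `C` are trivial, then the
  answer depends only on whether some marker is compatible with all input languages; for this
  reason the lifts use only such markers (`commonEnd`). Words with other ends can be covered for free,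
  since classes of `K` see the end of a word.

The new alphabet, the compatible markers and automata for the lifts are computed by bounded
searches, which are primitive recursive; `Ω` is the factorial of the number of subsets of `M`.
-/

namespace WordLang

/-! ### Words, suffixes and tagging -/

section Words

variable {A Y Z : Type}

theorem exists_append_rtake (N : ℕ) (w : List A) :
    ∃ x, w = x ++ w.rtake N ∧ ((w.rtake N).length = N ∨ x = []) := by
  refine ⟨w.take (w.length - N), by simp [List.rtake], ?_⟩
  rcases le_total N w.length with h | h
  · left; simp [List.rtake]; omega
  · right; simp [h]

theorem rtake_append_of_length_le {N : ℕ} (u v : List A) (h : N ≤ v.length) :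
    (u ++ v).rtake N = v.rtake N := by
  simp only [List.rtake, List.length_append, List.drop_append]
  rw [List.drop_eq_nil_of_le (by omega)]
  simp only [List.nil_append]
  congr 1; omega

theorem rtake_of_length_le {N : ℕ} (u : List A) (h : u.length ≤ N) : u.rtake N = u := by
  simp [List.rtake, h]

theorem rtake_append {N : ℕ} (u v : List A) :
    (u ++ v).rtake N = (u.rtake (N - v.length)) ++ v.rtake N := by
  simp only [List.rtake, List.length_append, List.drop_append]
  rcases le_total N v.length with h | h
  · have h1 : u.drop (u.length + v.length - N) = [] := List.drop_eq_nil_of_le (by omega)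
    have h2 : u.drop (u.length - (N - v.length)) = [] := List.drop_eq_nil_of_le (by omega)
    rw [h1, h2]
    congr 2; omega
  · congr 2 <;> omega

theorem rtake_rtake {N N' : ℕ} (h : N ≤ N') (u : List A) : (u.rtake N').rtake N = u.rtake N := by
  simp only [List.rtake, List.length_drop, List.drop_drop]
  congr 1; omega

/-- Two words agree on their last `N` letters (on all letters if they are shorter), and their
lengths agree modulo `d`. These are the data which the class `SU ∘ MOD` can see at a position. -/
def SufEq (N d : ℕ) (u v : List A) : Prop :=
  u.rtake N = v.rtake N ∧ u.length ≡ v.length [MOD d]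

namespace SufEq

variable {N N' d d' : ℕ} {u v w : List A}

theorem refl (u : List A) : SufEq N d u u := ⟨rfl, Nat.ModEq.refl _⟩

theorem trans (h : SufEq N d u v) (h' : SufEq N d v w) : SufEq N d u w :=
  ⟨h.1.trans h'.1, h.2.trans h'.2⟩

theorem mono (hN : N ≤ N') (hd : d ∣ d') (h : SufEq N' d' u v) : SufEq N d u v :=
  ⟨by rw [← rtake_rtake hN, h.1, rtake_rtake hN], h.2.of_dvd hd⟩

theorem append (h : SufEq N d u v) (w : List A) : SufEq N d (u ++ w) (v ++ w) := by
  refine ⟨?_, by simpa using h.2.add_right _⟩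
  rw [rtake_append, rtake_append, ← rtake_rtake (Nat.sub_le N w.length) u, h.1,
    rtake_rtake (Nat.sub_le N w.length) v]

theorem append_of_le (p p' : List A) {s : List A} (hs : N ≤ s.length)
    (h : p.length ≡ p'.length [MOD d]) : SufEq N d (p ++ s) (p' ++ s) :=
  ⟨by rw [rtake_append_of_length_le _ _ hs, rtake_append_of_length_le _ _ hs],
    by simpa using h.add_right _⟩

/-- Either the two words are equal, or they share a suffix of length `N`. -/
theorem cases (h : SufEq N d u v) : u = v ∨
    ∃ p p' s, u = p ++ s ∧ v = p' ++ s ∧ s.length = N ∧ p.length ≡ p'.length [MOD d] := by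
  obtain ⟨p, hp, hp'⟩ := exists_append_rtake N u
  obtain ⟨q, hq, hq'⟩ := exists_append_rtake N v
  rw [← h.1] at hq hq'
  by_cases hl : (u.rtake N).length = N
  · refine Or.inr ⟨p, q, _, hp, hq, hl, ?_⟩
    have := h.2
    rw [hp, hq] at this
    simp only [List.length_append] at this
    exact Nat.ModEq.add_right_cancel' _ this
  · left
    rw [hp, hq, hp'.resolve_left hl, hq'.resolve_left hl]

end SufEq

/-- The word whose `i`-th letter is `κ` applied to the prefix of length `i` of `w` and to the `i`-th
letter of `w`. -/
def tagWith (κ : List A → A → Y) (w : List A) : List Y :=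
  w.mapIdx fun i a => κ (w.take i) a

@[simp] theorem length_tagWith (κ : List A → A → Y) (w : List A) :
    (tagWith κ w).length = w.length := by simp [tagWith]

theorem tagWith_append (κ : List A → A → Y) (u v : List A) :
    tagWith κ (u ++ v) = tagWith κ u ++ tagWith (fun x => κ (u ++ x)) v := by
  simp only [tagWith, List.mapIdx_append]
  congr 1
  · apply List.ext_getElem
    · simp
    · intro i h1 h2
      have : i < u.length := by simpa using h1
      simp [List.take_append, Nat.sub_eq_zero_of_le this.le]
  · apply List.ext_getElem
    · simp
    · intro i h1 h2
      simp [List.take_append, List.take_of_length_le]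

theorem tagWith_concat (κ : List A → A → Y) (u : List A) (a : A) :
    tagWith κ (u ++ [a]) = tagWith κ u ++ [κ u a] := by
  rw [tagWith_append]; simp [tagWith]

theorem tagWith_tagWith (κ : List A → A → Y) (κ' : List Y → Y → Z) (w : List A) :
    tagWith κ' (tagWith κ w) = tagWith (fun u a => κ' (tagWith κ u) (κ u a)) w := by
  induction w using List.reverseRecOn with
  | nil => rfl
  | append_singleton w a ih => rw [tagWith_concat, tagWith_concat, tagWith_concat, ih]

theorem tagWith_shift_congr {N d : ℕ} {κ : List A → A → Y}
    (hκ : ∀ u v, SufEq N d u v → κ u = κ v) {u v : List A} (h : SufEq N d u v) (w : List A) :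
    tagWith (fun x => κ (u ++ x)) w = tagWith (fun x => κ (v ++ x)) w := by
  congr 1
  funext x
  exact hκ _ _ (h.append x)

theorem map_tagWith (g : Y → Z) (κ : List A → A → Y) (w : List A) :
    (tagWith κ w).map g = tagWith (fun u a => g (κ u a)) w := by
  induction w using List.reverseRecOn with
  | nil => rfl
  | append_singleton w a ih => rw [tagWith_concat, tagWith_concat, List.map_append, ih]; rfl

theorem FinPartition.tag_eq_tagWith (P : FinPartition A) (w : List A) :
    P.tag w = tagWith (fun u a => (P.block u, a)) w := rfl

end Words

/-! ### Partitions into suffix and modulo languages -/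

section Partitions

variable {A : Type}

namespace FinPartition

theorem block_eq_iff (P : FinPartition A) (u : List A) (p : P.parts) :
    P.block u = p ↔ u ∈ (p : Set (List A)) := by
  constructor
  · rintro rfl; exact P.mem_block u
  · intro h
    obtain ⟨q, _, hq⟩ := P.isPartition.2 u
    apply Subtype.ext
    rw [hq _ ⟨p.2, h⟩, hq _ ⟨(P.block u).2, P.mem_block u⟩]

theorem block_congr (P : FinPartition A) {u v : List A}
    (h : ∀ p ∈ P.parts, u ∈ p → v ∈ p) : P.block u = P.block v :=
  ((P.block_eq_iff v _).2 (h _ (P.block u).2 (P.mem_block u))).symm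

/-- The partition of the words into the fibres of a map with finite range. -/
def ofMap {Y : Type} (g : List A → Y) (hg : (Set.range g).Finite) : FinPartition A where
  parts := (Setoid.ker g).classes
  finite := by
    have : (Setoid.ker g).classes ⊆ (fun y => {x | g x = y}) '' Set.range g := by
      rintro _ ⟨y, rfl⟩
      exact ⟨g y, ⟨y, rfl⟩, rfl⟩
    exact (hg.image _).subset this
  isPartition := Setoid.isPartition_classes _

theorem ofMap_block_eq_iff {Y : Type} (g : List A → Y) (hg : (Set.range g).Finite)
    (u v : List A) : (ofMap g hg).block u = (ofMap g hg).block v ↔ g u = g v := by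
  rw [block_eq_iff]
  obtain ⟨y, hy⟩ := ((ofMap g hg).block v).2
  have hv : v ∈ {x | Setoid.ker g x y} := hy ▸ (ofMap g hg).mem_block v
  rw [hy]
  have : g v = g y := hv
  change g u = g y ↔ _
  rw [this]

theorem mem_parts_ofMap {Y : Type} {g : List A → Y} {hg : (Set.range g).Finite}
    {K : Set (List A)} (h : K ∈ (ofMap g hg).parts) : ∃ v, K = {u | g u = g v} := h

theorem mem_liftable [Finite A] [Nonempty A] (P : FinPartition A)
    {F : P.parts → Set (List (P.parts × A))} (w : List A) :
    (w ∈ ⋃ p : P.parts, (P.tag ⁻¹' F p) ∩ p) ↔ P.tag w ∈ F (P.block w) := by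
  simp only [Set.mem_iUnion]
  constructor
  · rintro ⟨p, h1, h2⟩
    rw [(P.block_eq_iff w p).2 h2]; exact h1
  · intro h
    exact ⟨_, h, P.mem_block w⟩

end FinPartition

theorem finite_rtake_range [Finite A] (N : ℕ) :
    (Set.range fun w : List A => w.rtake N).Finite := by
  refine (List.finite_length_le A N).subset ?_
  rintro _ ⟨w, rfl⟩
  change (w.rtake N).length ≤ N
  simp [List.rtake]; omega

variable [Finite A] [Nonempty A]

theorem exists_modulus_of_mem_MOD {K : Set (List A)} (hK : K ∈ MOD A) :
    ∃ d > 0, ∀ u v : List A, u.length ≡ v.length [MOD d] → (u ∈ K ↔ v ∈ K) := by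
  refine BooleanSubalgebra.closure_bot_sup_induction
    (p := fun K _ => ∃ d > 0, ∀ u v : List A, u.length ≡ v.length [MOD d] → (u ∈ K ↔ v ∈ K))
    ?_ ?_ ?_ ?_ hK
  · rintro _ ⟨m, d, hm, rfl⟩
    exact ⟨d, by omega, fun u v h => ⟨fun h' => h.symm.trans h', fun h' => h.trans h'⟩⟩
  · exact ⟨1, one_pos, fun u v _ => Iff.rfl⟩
  · rintro x _ y _ ⟨d, hd, h⟩ ⟨e, he, h'⟩
    refine ⟨d * e, Nat.mul_pos hd he, fun u v huv => ?_⟩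
    exact or_congr (h u v (huv.of_dvd (Dvd.intro _ rfl))) (h' u v (huv.of_dvd (Dvd.intro_left _ rfl)))
  · rintro x _ ⟨d, hd, h⟩
    exact ⟨d, hd, fun u v huv => not_congr (h u v huv)⟩

theorem exists_bound_of_mem_SU {K : Set (List A)} (hK : K ∈ SU A) :
    ∃ N, ∀ u v : List A, u.rtake N = v.rtake N → (u ∈ K ↔ v ∈ K) := by
  refine BooleanSubalgebra.closure_bot_sup_induction
    (p := fun K _ => ∃ N, ∀ u v : List A, u.rtake N = v.rtake N → (u ∈ K ↔ v ∈ K))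
    ?_ ?_ ?_ ?_ hK
  · rintro _ ⟨w, rfl⟩
    refine ⟨w.length, fun u v h => ?_⟩
    have key : ∀ u : List A, w <:+ u ↔ u.rtake w.length = w := fun u =>
      ⟨by rintro ⟨t, rfl⟩; rw [rtake_append_of_length_le _ _ le_rfl, rtake_of_length_le _ le_rfl],
        fun h => by rw [← h]; exact List.drop_suffix _ _⟩
    change w <:+ u ↔ w <:+ v
    rw [key, key, h]
  · exact ⟨0, fun u v _ => Iff.rfl⟩
  · rintro x _ y _ ⟨N, h⟩ ⟨N', h'⟩
    refine ⟨max N N', fun u v huv => or_congr (h u v ?_) (h' u v ?_)⟩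
    · rw [← rtake_rtake (le_max_left N N'), huv, rtake_rtake (le_max_left N N')]
    · rw [← rtake_rtake (le_max_right N N'), huv, rtake_rtake (le_max_right N N')]
  · rintro x _ ⟨d, h⟩
    exact ⟨d, fun u v huv => not_congr (h u v huv)⟩

theorem length_modEq_mem_MOD (d : ℕ) (hd : 0 < d) (v : List A) :
    {u : List A | u.length % d = v.length % d} ∈ MOD A := by
  refine BooleanSubalgebra.subset_closure ⟨v.length % d, d, Nat.mod_lt _ hd, ?_⟩
  ext u
  simp [Nat.ModEq]

theorem suffix_mem_SU (w : List A) : {u : List A | w <:+ u} ∈ SU A :=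
  BooleanSubalgebra.subset_closure ⟨w, rfl⟩

theorem singleton_mem_SU (w : List A) : {w} ∈ SU A := by
  have h : ({w} : Set (List A)) =
      {u : List A | w <:+ u} \ ⋃ a ∈ (Set.univ : Set A), {u : List A | (a :: w) <:+ u} := by
    ext u
    simp only [Set.mem_singleton_iff, Set.mem_sdiff, Set.mem_ofPred_eq, Set.mem_iUnion, Set.mem_univ,
      exists_const, not_exists]
    constructor
    · rintro rfl
      exact ⟨List.suffix_rfl, fun a ha => by simpa using ha.length_le⟩
    · rintro ⟨⟨t, rfl⟩, h⟩
      rcases t.eq_nil_or_concat with rfl | ⟨t', a, rfl⟩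
      · rfl
      · exact absurd ⟨t', by simp⟩ (h a)
  rw [h]
  refine BooleanSubalgebra.sdiff_mem (suffix_mem_SU w) ?_
  refine Set.Finite.induction_on_subset (motive := fun s _ =>
    (⋃ a ∈ s, {u : List A | (a :: w) <:+ u}) ∈ SU A) _ Set.finite_univ ?_ ?_
  · simp only [Set.mem_empty_iff_false, Set.iUnion_of_empty, Set.iUnion_empty]
    exact BooleanSubalgebra.bot_mem
  · intro a s _ _ _ ih
    rw [Set.biUnion_insert]
    exact BooleanSubalgebra.sup_mem (suffix_mem_SU _) ih

theorem rtake_eq_mem_SU (N : ℕ) (v : List A) : {u : List A | u.rtake N = v.rtake N} ∈ SU A := by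
  obtain ⟨x, hx, h⟩ := exists_append_rtake N v
  by_cases hl : (v.rtake N).length = N
  · convert suffix_mem_SU (v.rtake N) using 1
    ext u
    refine ⟨fun h => h ▸ List.drop_suffix _ _, ?_⟩
    rintro ⟨t, rfl⟩
    change (t ++ v.rtake N).rtake N = _
    rw [rtake_append_of_length_le _ _ hl.ge, rtake_rtake le_rfl]
  · have hv : v.rtake N = v := by
      rw [h.resolve_left hl] at hx; exact hx.symm
    convert singleton_mem_SU v using 1
    ext u
    simp only [Set.mem_ofPred_eq, Set.mem_singleton_iff]
    rw [hv]
    refine ⟨fun hu => ?_, fun hu => by rw [hu, hv]⟩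
    obtain ⟨y, hy, h'⟩ := exists_append_rtake N u
    rw [hu] at hy h'
    rw [hv] at hl
    rw [hy, h'.resolve_left hl]; rfl

end Partitions

/-! ### Positive varieties -/

section Varieties

variable {C : LanguageClass} {A B : Type} [Finite A] [Nonempty A] [Finite B] [Nonempty B]

theorem IsPositiveVariety.flatMap_mem (hC : IsPositiveVariety C) (g : A → List B)
    {L : Set (List B)} (hL : L ∈ C B) : {w : List A | w.flatMap g ∈ L} ∈ C A := by
  convert hC.preimage_mem A B (FreeMonoid.lift fun a => FreeMonoid.ofList (g a)) L hL using 1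
  ext w
  simp only [Set.mem_ofPred_eq]
  rw [FreeMonoid.lift_apply]
  simp only [FreeMonoid.toList_ofList, FreeMonoid.toList_prod, List.map_map]
  rw [List.flatMap_def]
  rfl

theorem IsPositiveVariety.biUnion_mem (hC : IsPositiveVariety C) {ι : Type} {s : Set ι}
    (hs : s.Finite) {F : ι → Set (List A)} (hF : ∀ i ∈ s, F i ∈ C A) : (⋃ i ∈ s, F i) ∈ C A := by
  refine Set.Finite.induction_on_subset (motive := fun t _ => (⋃ i ∈ t, F i) ∈ C A) _ hs ?_ ?_
  · simpa using hC.empty_mem A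
  · intro a t ha _ _ ih
    rw [Set.biUnion_insert]
    exact hC.union_mem A _ (hF a ha) _ ih

end Varieties

/-! ### The enriched class `(C ∘ SU) ∘ MOD` -/

section Enrichment

theorem rtake_tagWith_congr {A Y : Type} {κ : List A → A → Y} {N d : ℕ}
    (hκ : ∀ u v, u.length ≡ v.length [MOD d] → κ u = κ v) {u v : List A} (h : SufEq N d u v) :
    (tagWith κ u).rtake N = (tagWith κ v).rtake N := by
  rcases h.cases with rfl | ⟨p, p', s, rfl, rfl, hs, hp⟩
  · rfl
  · rw [tagWith_append, tagWith_append, rtake_append_of_length_le _ _ (by simp [hs]),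
      rtake_append_of_length_le _ _ (by simp [hs])]
    congr 2
    funext x
    exact hκ _ _ (by simpa using hp.add_right _)

variable {C : LanguageClass} {A Λ : Type} [Finite A] [Nonempty A] [Finite Λ] [Nonempty Λ]

/-- Sufficient condition for membership in `(C ∘ SU) ∘ MOD`: a transduction that outputs, at each
position, a word depending on the letter and on the `SufEq`-class of the prefix before it pulls back
languages of `C`, and the language of `C` may depend on the `SufEq`-class of the input word. -/
theorem mem_enrich_SU_MOD (hC : IsPositiveVariety C) {N d : ℕ} (hd : 0 < d)
    {φ : List A → A → List Λ} {H : List A → Set (List Λ)}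
    (hφ : ∀ u v, SufEq N d u v → φ u = φ v) (hH : ∀ u v, SufEq N d u v → H u = H v)
    (hHC : ∀ u, H u ∈ C Λ) :
    {w | (tagWith φ w).flatten ∈ H w} ∈ enrich (enrich C SU) MOD A := by
  classical
  have hfin : (Set.range fun w : List A => w.length % d).Finite := by
    refine (Set.finite_lt_nat d).subset ?_
    rintro _ ⟨w, rfl⟩
    exact Nat.mod_lt _ hd
  let P : FinPartition A := FinPartition.ofMap (fun w => w.length % d) hfin
  let Q : FinPartition (P.parts × A) :=
    FinPartition.ofMap (fun w => w.rtake N) (finite_rtake_range N)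
  let rep : P.parts → Q.parts → List A := fun p q =>
    if h : ∃ w, P.block w = p ∧ Q.block (P.tag w) = q then h.choose else []
  have hrep : ∀ w, SufEq N d (rep (P.block w) (Q.block (P.tag w))) w := by
    intro w
    have hex : ∃ w', P.block w' = P.block w ∧ Q.block (P.tag w') = Q.block (P.tag w) :=
      ⟨w, rfl, rfl⟩
    have hr : rep (P.block w) (Q.block (P.tag w)) = hex.choose := dif_pos hex
    rw [hr]
    obtain ⟨h1, h2⟩ := hex.choose_spec
    generalize hex.choose = w' at h1 h2
    have h1' := (FinPartition.ofMap_block_eq_iff _ hfin _ _).1 h1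
    have h2' := (FinPartition.ofMap_block_eq_iff _ (finite_rtake_range N) _ _).1 h2
    refine ⟨?_, h1'⟩
    have h3 := congrArg (List.map Prod.snd) h2'
    have h4 : ∀ x : List A, ((P.tag x).rtake N).map Prod.snd = x.rtake N := by
      intro x
      have h5 : (P.tag x).map Prod.snd = x := by
        rw [FinPartition.tag_eq_tagWith, map_tagWith]
        induction x using List.reverseRecOn with
        | nil => rfl
        | append_singleton x a ih => rw [tagWith_concat, ih]
      conv_rhs => rw [← h5]
      simp [List.rtake, List.map_drop]
    rw [← h4, ← h4, ← h2']
  let g : Q.parts × (P.parts × A) → List Λ := fun x => φ (rep x.2.1 x.1) x.2.2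
  let G : P.parts → Q.parts → Set (List (Q.parts × (P.parts × A))) := fun p q =>
    {z | z.flatMap g ∈ H (rep p q)}
  refine ⟨P, ?_, fun p => ⋃ q : Q.parts, (Q.tag ⁻¹' G p q) ∩ q, ?_, ?_⟩
  · rintro K hK
    obtain ⟨v, rfl⟩ := FinPartition.mem_parts_ofMap hK
    exact length_modEq_mem_MOD d hd v
  · intro p
    refine ⟨Q, ?_, G p, fun q => hC.flatMap_mem g (hHC _), rfl⟩
    rintro K hK
    obtain ⟨v, rfl⟩ := FinPartition.mem_parts_ofMap hK
    exact rtake_eq_mem_SU N v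
  · ext w
    rw [FinPartition.mem_liftable, FinPartition.mem_liftable]
    have h1 : (Q.tag (P.tag w)).flatMap g = (tagWith φ w).flatten := by
      rw [Q.tag_eq_tagWith, P.tag_eq_tagWith, tagWith_tagWith, List.flatMap_def, map_tagWith]
      congr 2
      funext u a
      exact congrFun (hφ _ _ (hrep u)) a
    change _ ↔ (Q.tag (P.tag w)).flatMap g ∈ H (rep (P.block w) (Q.block (P.tag w)))
    rw [h1, hH _ _ (hrep w)]
    rfl

/-- Converse of `mem_enrich_SU_MOD`, in a local form: on each `SufEq`-class, membership in a
language of `(C ∘ SU) ∘ MOD` is tested by a language of `C` on a tagged word. -/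
theorem exists_tagWith_of_mem_enrich {K : Set (List A)} (hK : K ∈ enrich (enrich C SU) MOD A) :
    ∃ N d, 0 < d ∧ ∀ w₀ : List A, ∃ (Y : Type) (_ : Finite Y) (_ : Nonempty Y)
      (κ : List A → A → Y) (F : Set (List Y)), (∀ u v, SufEq N d u v → κ u = κ v) ∧ F ∈ C Y ∧
      ∀ w, SufEq N d w w₀ → (w ∈ K ↔ tagWith κ w ∈ F) := by
  obtain ⟨P, hP, F, hF, rfl⟩ := hK
  have hd : ∃ d > 0, ∀ u v : List A, u.length ≡ v.length [MOD d] → P.block u = P.block v := by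
    choose! e he h using fun (K : Set (List A)) (hK : K ∈ P.parts) =>
      exists_modulus_of_mem_MOD (hP K hK)
    refine ⟨∏ K ∈ P.finite.toFinset, e K,
      Finset.prod_pos fun K hK => he K (by simpa using hK), fun u v huv => ?_⟩
    refine P.block_congr fun p hp hu => ?_
    exact (h p hp u v (huv.of_dvd (Finset.dvd_prod_of_mem e (by simpa using hp)))).1 hu
  obtain ⟨d, hd, hd'⟩ := hd
  choose Q hQ G hG hFG using hF
  have hN : ∃ N, ∀ p u v, u.rtake N = v.rtake N → (Q p).block u = (Q p).block v := by
    choose! e h using fun (p : P.parts) (K : Set (List (P.parts × A))) (hK : K ∈ (Q p).parts) =>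
      exists_bound_of_mem_SU (hQ p K hK)
    have := Fintype.ofFinite P.parts
    refine ⟨∑ p : P.parts, ∑ K ∈ (Q p).finite.toFinset, e p K, fun p u v huv => ?_⟩
    refine (Q p).block_congr fun q hq hu => ?_
    refine (h p q hq u v ?_).1 hu
    have hle : e p q ≤ ∑ p : P.parts, ∑ K ∈ (Q p).finite.toFinset, e p K :=
      (Finset.single_le_sum (f := e p) (fun _ _ => Nat.zero_le _) (by simpa using hq)).trans
        (Finset.single_le_sum (f := fun p => ∑ K ∈ (Q p).finite.toFinset, e p K)
          (fun _ _ => Nat.zero_le _) (Finset.mem_univ p))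
    rw [← rtake_rtake hle, huv, rtake_rtake hle]
  obtain ⟨N, hN⟩ := hN
  refine ⟨N, d, hd, fun w₀ => ?_⟩
  let p := P.block w₀
  have htag : ∀ u v, SufEq N d u v → (Q p).block (P.tag u) = (Q p).block (P.tag v) := by
    intro u v h
    refine hN _ _ _ ?_
    rw [P.tag_eq_tagWith, P.tag_eq_tagWith]
    exact rtake_tagWith_congr (fun u v huv => by funext a; rw [hd' u v huv]) h
  refine ⟨(Q p).parts × (P.parts × A), inferInstance, inferInstance,
    fun u a => ((Q p).block (P.tag u), (P.block u, a)), G p ((Q p).block (P.tag w₀)), ?_, hG _ _, ?_⟩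
  · intro u v h
    funext a
    exact Prod.ext (htag u v h) (Prod.ext (hd' u v h.2) rfl)
  · intro w hw
    rw [FinPartition.mem_liftable, hd' w w₀ hw.2, hFG, FinPartition.mem_liftable]
    change (Q p).tag (P.tag w) ∈ G p ((Q p).block (P.tag w)) ↔ _
    rw [htag _ _ hw, (Q p).tag_eq_tagWith, P.tag_eq_tagWith w, tagWith_tagWith]
    rfl

end Enrichment

/-! ### Testing a marker in a non-trivial positive variety -/

/-- If `C` contains a non-trivial language, then languages of `C` can tell which marker ends a word
that contains no other marker. Indeed, some quotient of a non-trivial language contains exactly one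
of `ε` and a one-letter word `b`; one erases all letters but those that must be accepted (or
rejected) and sends these to `b`. -/
theorem IsPositiveVariety.exists_marker_test {C : LanguageClass} (hC : IsPositiveVariety C)
    {B : Type} [Finite B] [Nonempty B] {L : Set (List B)} (hL : L ∈ C B) (hne : L ≠ ∅)
    (hnu : L ≠ Set.univ) {Λ : Type} [Finite Λ] [Nonempty Λ] {S : Set Λ} {s : Λ} (hs : s ∈ S) :
    ∃ H ∈ C Λ, ∀ y : List Λ, (∀ l ∈ y, l ∉ S) → ∀ l ∈ S, (y ++ [l] ∈ H ↔ l = s) := by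
  classical
  have hflip : ∃ u b, ¬ (u ∈ L ↔ u ++ [b] ∈ L) := by
    by_contra! hcon
    have hall : ∀ u, u ∈ L ↔ [] ∈ L := by
      intro u
      induction u using List.reverseRecOn with
      | nil => rfl
      | append_singleton u b ih => rw [← hcon, ih]
    obtain ⟨u, hu⟩ := Set.nonempty_iff_ne_empty.2 hne
    exact hnu (Set.eq_univ_of_forall fun v => (hall v).2 ((hall u).1 hu))
  obtain ⟨u, b, hub⟩ := hflip
  have hmem := hC.left_quotient_mem B L hL u
  have herase : ∀ (g : Λ → List B), (∀ l ∉ S, g l = []) → ∀ y : List Λ, (∀ l ∈ y, l ∉ S) →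
      ∀ l, (y ++ [l]).flatMap g = g l := by
    intro g hg y hy l
    rw [List.flatMap_append, List.flatMap_eq_nil_iff.2 fun l hl => hg l (hy l hl)]
    simp
  by_cases hu : u ∈ L
  · have hu' : u ++ [b] ∉ L := fun h => hub ⟨fun _ => h, fun _ => hu⟩
    refine ⟨_, hC.flatMap_mem (fun l => if l ∈ S ∧ l ≠ s then [b] else []) hmem,
      fun y hy l hl => ?_⟩
    rw [Set.mem_ofPred_eq, herase _ (fun l hl => if_neg fun h => hl h.1) y hy]
    by_cases h : l = s <;> simp [h, hl, hu, hu']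
  · have hu' : u ++ [b] ∈ L := by tauto
    refine ⟨_, hC.flatMap_mem (fun l => if l = s then [b] else []) hmem, fun y hy l hl => ?_⟩
    rw [Set.mem_ofPred_eq, herase _ (fun l hl => if_neg fun h : l = s => hl (h ▸ hs)) y hy]
    by_cases h : l = s <;> simp [h, hu, hu']

/-! ### Idempotent powers in finite monoids -/

theorem isIdempotentElem_pow_factorial {G : Type*} [Monoid G] [Finite G] (x : G) :
    x ^ (Nat.card G).factorial * x ^ (Nat.card G).factorial = x ^ (Nat.card G).factorial := by
  set k := (Nat.card G).factorial with hk
  obtain ⟨i, j, hij, hx⟩ : ∃ i j : Fin (Nat.card G + 1), i < j ∧ x ^ (i : ℕ) = x ^ (j : ℕ) := by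
    have := Fintype.ofFinite G
    obtain ⟨i, j, hij, h⟩ := Fintype.exists_ne_map_eq_of_card_lt
      (fun i : Fin (Nat.card G + 1) => x ^ (i : ℕ)) (by simp [Nat.card_eq_fintype_card])
    rcases lt_or_gt_of_ne hij with h' | h'
    · exact ⟨i, j, h', h⟩
    · exact ⟨j, i, h', h.symm⟩
  have hij' : (i : ℕ) < j := hij
  have hj : (j : ℕ) ≤ Nat.card G := Nat.lt_succ_iff.1 j.2
  have hik : (i : ℕ) ≤ k := by
    have := Nat.self_le_factorial (Nat.card G)
    omega
  obtain ⟨t, ht⟩ : (j : ℕ) - i ∣ k := Nat.dvd_factorial (by omega) (by omega)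
  have hstep : ∀ n, (i : ℕ) ≤ n → ∀ t, x ^ (n + (j - i) * t) = x ^ n := by
    intro n hn t
    induction t with
    | zero => simp
    | succ t ih =>
      rw [← ih, show n + ((j : ℕ) - i) * (t + 1) = (n - i + (j - i) * t) + j by
        rw [Nat.mul_succ]; omega, pow_add, ← hx, ← pow_add]
      congr 1; omega
  rw [← pow_add]
  conv_lhs => rw [show k + k = k + (j - i) * t by rw [← ht]]
  exact hstep k hik t

section Monoid

open scoped Pointwise

variable {A M : Type} [Monoid M]

/-- The value of a word under the monoid morphism `A* → M` that extends `μ`. -/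
def ev (μ : A → M) (w : List A) : M := (w.map μ).prod

@[simp] theorem ev_nil (μ : A → M) : ev μ [] = 1 := rfl

@[simp] theorem ev_append (μ : A → M) (u v : List A) : ev μ (u ++ v) = ev μ u * ev μ v := by
  simp [ev]

/-- The `n`-th power of a word. -/
def powWord (f : List A) (n : ℕ) : List A := (List.replicate n f).flatten

@[simp] theorem powWord_zero (f : List A) : powWord f 0 = [] := rfl

theorem powWord_succ (f : List A) (n : ℕ) : powWord f (n + 1) = f ++ powWord f n := by
  simp [powWord, List.replicate_succ]

@[simp] theorem powWord_nil (n : ℕ) : powWord ([] : List A) n = [] := by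
  simp [powWord]

@[simp] theorem length_powWord (f : List A) (n : ℕ) : (powWord f n).length = n * f.length := by
  simp [powWord]

@[simp] theorem ev_powWord (μ : A → M) (f : List A) (n : ℕ) :
    ev μ (powWord f n) = ev μ f ^ n := by
  induction n with
  | zero => simp
  | succ n ih => rw [powWord_succ, ev_append, ih, pow_succ']

theorem mem_range_pow_iff (μ : A → M) (n : ℕ) (x : M) :
    x ∈ (Set.range μ) ^ n ↔ ∃ w : List A, w.length = n ∧ ev μ w = x := by
  induction n generalizing x with
  | zero => simp [eq_comm]
  | succ n ih =>
    rw [pow_succ, Set.mem_mul]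
    constructor
    · rintro ⟨y, hy, _, ⟨a, rfl⟩, rfl⟩
      obtain ⟨w, hw, rfl⟩ := (ih y).1 hy
      exact ⟨w ++ [a], by simp [hw], by simp [ev]⟩
    · rintro ⟨w, hw, rfl⟩
      rcases w.eq_nil_or_concat with rfl | ⟨w, a, rfl⟩
      · simp at hw
      · exact ⟨ev μ w, (ih _).2 ⟨w, by simpa using hw, rfl⟩, μ a, ⟨a, rfl⟩, by simp [ev]⟩

/-- `Ω` is a stability exponent of `M`: every subset of `M` has an idempotent `Ω`-th power. -/
structure IsStable (M : Type) [Monoid M] (Ω : ℕ) : Prop where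
  pos : 0 < Ω
  idem : ∀ X : Set M, X ^ Ω * X ^ Ω = X ^ Ω

theorem isStable_factorial (M : Type) [Monoid M] [Finite M] :
    IsStable M (Nat.card (Set M)).factorial :=
  ⟨Nat.factorial_pos _, isIdempotentElem_pow_factorial⟩

variable {Ω : ℕ}

theorem IsStable.pow_pow (hΩ : IsStable M Ω) (x : M) {k : ℕ} (hk : 0 < k) :
    (x ^ Ω) ^ k = x ^ Ω := by
  have h : IsIdempotentElem (x ^ Ω) := by
    have := hΩ.idem {x}
    unfold IsIdempotentElem
    simpa only [Set.singleton_pow, Set.singleton_mul_singleton, Set.singleton_eq_singleton_iff]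
      using this
  obtain ⟨k, rfl⟩ := Nat.exists_eq_succ_of_ne_zero hk.ne'
  exact h.pow_succ_eq k

/-- All words whose length is a positive multiple of `Ω` have the same set of values, for each
such length. -/
theorem IsStable.exists_length_eq (hΩ : IsStable M Ω) (μ : A → M) {w : List A} {j k : ℕ}
    (hj : 0 < j) (hk : 0 < k) (hw : w.length = Ω * j) :
    ∃ v : List A, v.length = Ω * k ∧ ev μ v = ev μ w := by
  have h : IsIdempotentElem ((Set.range μ) ^ Ω) := hΩ.idem _
  rw [← mem_range_pow_iff, pow_mul]
  obtain ⟨k, rfl⟩ := Nat.exists_eq_succ_of_ne_zero hk.ne'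
  obtain ⟨j, rfl⟩ := Nat.exists_eq_succ_of_ne_zero hj.ne'
  rw [h.pow_succ_eq k, ← h.pow_succ_eq j, ← pow_mul, mem_range_pow_iff]
  exact ⟨w, hw, rfl⟩

end Monoid

/-! ### Factorising words at stabilised positions -/

section Scan

variable {A M : Type} [Monoid M] (μ : A → M) (Ω : ℕ)

/-- A letter `(q, v, f)` of the new alphabet. It stands for a factor with value `v f^Ω` between a
position stabilised by `q` and one stabilised by `f`, where `q` is empty at the beginning of the
word. The letters with `f = []` serve as end markers: `(q, v, [])` announces that the word ends with
the factor `v` after a position stabilised by `q`. -/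
abbrev Letter (A : Type) : Type := List A × List A × List A

/-- The words of letters that describe consecutive factors, from `q` to `q'`. -/
def Path : List A → List (Letter A) → List A → Prop
  | q, [], q' => q = q'
  | q, l :: x, q' => l.1 = q ∧ l.2.1.length = Ω ∧ l.2.2.length = Ω ∧ Path l.2.2 x q'

theorem Path.append {q q' q'' : List A} {x y : List (Letter A)} (h : Path Ω q x q')
    (h' : Path Ω q' y q'') : Path Ω q (x ++ y) q'' := by
  induction x generalizing q with
  | nil => cases h; exact h'
  | cons l x ih => exact ⟨h.1, h.2.1, h.2.2.1, ih h.2.2.2⟩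

/-- A word over `A` described by a word of letters. -/
def spell (x : List (Letter A)) : List A := x.flatMap fun l => l.2.1 ++ powWord l.2.2 Ω

@[simp] theorem spell_nil : spell Ω ([] : List (Letter A)) = [] := rfl

theorem spell_cons (l : Letter A) (x : List (Letter A)) :
    spell Ω (l :: x) = l.2.1 ++ powWord l.2.2 Ω ++ spell Ω x := rfl

theorem spell_append (x y : List (Letter A)) : spell Ω (x ++ y) = spell Ω x ++ spell Ω y := by
  simp [spell]

/-- The word `f` of length `Ω` stabilises the value of `x`. -/
def Stabilizes (x f : List A) : Prop := f.length = Ω ∧ ev μ x * ev μ f ^ Ω = ev μ x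

/-- The number of last letters that are inspected to decide whether a position is stabilised. -/
noncomputable def window (M : Type) (Ω : ℕ) : ℕ := Nat.card M * Ω

/-- The position at the end of the prefix `w` is a multiple of `Ω`, and the value of the
window before it is stabilised by some word. -/
def Stabilized (w : List A) : Prop :=
  Ω ∣ w.length ∧ ∃ f, Stabilizes μ Ω (w.rtake (window M Ω)) f

open Classical in
/-- A stabilising word, chosen as a function of the window. -/
noncomputable def stabilizer (w : List A) : List A :=
  if h : ∃ f, Stabilizes μ Ω (w.rtake (window M Ω)) f then h.choose else []

open Classical in
/-- A word of length `Ω` with the same value as `x`, if there is one. -/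
noncomputable def shortRep (x : List A) : List A :=
  if h : ∃ v : List A, v.length = Ω ∧ ev μ v = ev μ x then h.choose else []

open Classical in
/-- `scan` on the mirror image of a word. -/
noncomputable def scanRev : List A → List A × List A
  | [] => ([], [])
  | a :: r =>
    if Stabilized μ Ω (a :: r).reverse then (stabilizer μ Ω (a :: r).reverse, [])
    else ((scanRev r).1, (scanRev r).2 ++ [a])

/-- The stabilising word at the last stabilised position of `w` (the empty word if there is no such
position), and the part of `w` after this position. -/
noncomputable def scan (w : List A) : List A × List A := scanRev μ Ω w.reverse

open Classical in
/-- The letters that are output when `a` is read after the prefix `w`: one letter if this reaches a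
stabilised position, none otherwise. -/
noncomputable def emit (w : List A) (a : A) : List (Letter A) :=
  if Stabilized μ Ω (w ++ [a]) then
    [((scan μ Ω w).1, shortRep μ Ω ((scan μ Ω w).2 ++ [a]), stabilizer μ Ω (w ++ [a]))]
  else []

/-- The word of letters that describes the factorisation of `w` at its stabilised positions, without
the part after the last one. -/
noncomputable def factorisation (w : List A) : List (Letter A) := (tagWith (emit μ Ω) w).flatten

variable {μ Ω}

@[simp] theorem scan_nil : scan μ Ω [] = ([], []) := rfl

theorem scan_concat_of_stabilized {w : List A} {a : A} (h : Stabilized μ Ω (w ++ [a])) :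
    scan μ Ω (w ++ [a]) = (stabilizer μ Ω (w ++ [a]), []) := by
  have h' : Stabilized μ Ω (a :: w.reverse).reverse := by simpa using h
  simp only [scan, List.reverse_append, List.reverse_singleton, List.singleton_append, scanRev]
  rw [if_pos h']
  simp

theorem scan_concat_of_not_stabilized {w : List A} {a : A} (h : ¬ Stabilized μ Ω (w ++ [a])) :
    scan μ Ω (w ++ [a]) = ((scan μ Ω w).1, (scan μ Ω w).2 ++ [a]) := by
  have h' : ¬ Stabilized μ Ω (a :: w.reverse).reverse := by simpa using h
  simp only [scan, List.reverse_append, List.reverse_singleton, List.singleton_append, scanRev]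
  rw [if_neg h']

theorem stabilizer_congr {u v : List A} (h : SufEq (window M Ω) Ω u v) :
    stabilizer μ Ω u = stabilizer μ Ω v := by
  unfold stabilizer; rw [h.1]

theorem stabilized_congr {u v : List A} (h : SufEq (window M Ω) Ω u v) :
    Stabilized μ Ω u ↔ Stabilized μ Ω v := by
  unfold Stabilized
  rw [h.1, (Nat.ModEq.dvd_iff h.2 dvd_rfl)]

theorem stabilizes_stabilizer {w : List A} (h : Stabilized μ Ω w) :
    Stabilizes μ Ω (w.rtake (window M Ω)) (stabilizer μ Ω w) := by
  unfold stabilizer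
  rw [dif_pos h.2]
  exact h.2.choose_spec

theorem length_stabilizer {w : List A} (h : Stabilized μ Ω w) :
    (stabilizer μ Ω w).length = Ω := (stabilizes_stabilizer h).1

theorem ev_mul_stabilizer {w : List A} (h : Stabilized μ Ω w) :
    ev μ w * ev μ (stabilizer μ Ω w) ^ Ω = ev μ w := by
  obtain ⟨x, hx, _⟩ := exists_append_rtake (window M Ω) w
  have h1 := (stabilizes_stabilizer h).2
  conv_lhs => rw [hx]
  conv_rhs => rw [hx]
  rw [ev_append, mul_assoc, ← hx, h1]

theorem shortRep_spec (hΩ : IsStable M Ω) {x : List A} (hx : x ≠ []) (hd : Ω ∣ x.length) :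
    (shortRep μ Ω x).length = Ω ∧ ev μ (shortRep μ Ω x) = ev μ x := by
  have h : ∃ v : List A, v.length = Ω ∧ ev μ v = ev μ x := by
    obtain ⟨j, hj⟩ := hd
    have hj0 : 0 < j := by
      rcases Nat.eq_zero_or_pos j with rfl | h
      · simp at hj; exact absurd hj hx
      · exact h
    simpa using hΩ.exists_length_eq μ hj0 one_pos hj
  unfold shortRep
  rw [dif_pos h]
  exact h.choose_spec

/-- Every sufficiently long factor contains a stabilised position: by the pigeonhole principle two of
the prefixes of the factor that end at multiples of `Ω` have the same value, and what lies between
them stabilises. -/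
theorem exists_stabilized [Finite M] (hΩ : IsStable M Ω) (p s : List A)
    (hs : (Nat.card M + 1) * Ω ≤ s.length) :
    ∃ s₁ s₂, s = s₁ ++ s₂ ∧ s₁ ≠ [] ∧ Stabilized μ Ω (p ++ s₁) := by
  have hpos := hΩ.pos
  -- the first positive position in `s` at which a prefix of `p ++ s` has length a multiple of `Ω`
  obtain ⟨k, hk0, hkΩ, hk⟩ : ∃ k, 0 < k ∧ k ≤ Ω ∧ Ω ∣ p.length + k := by
    refine ⟨Ω - p.length % Ω, ?_, Nat.sub_le _ _, ?_⟩
    · have := Nat.mod_lt p.length hpos; omega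
    · have h1 := Nat.mod_lt p.length hpos
      have h2 := Nat.div_add_mod p.length Ω
      refine ⟨p.length / Ω + 1, ?_⟩
      rw [Nat.mul_succ]; omega
  have hg : ∃ i j : Fin (Nat.card M + 1), i < j ∧
      ev μ ((s.drop k).take (i * Ω)) = ev μ ((s.drop k).take (j * Ω)) := by
    have := Fintype.ofFinite M
    obtain ⟨i, j, hij, h⟩ := Fintype.exists_ne_map_eq_of_card_lt
      (fun i : Fin (Nat.card M + 1) => ev μ ((s.drop k).take (i * Ω)))
      (by simp [Nat.card_eq_fintype_card])
    rcases lt_or_gt_of_ne hij with h' | h'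
    · exact ⟨i, j, h', h⟩
    · exact ⟨j, i, h', h.symm⟩
  obtain ⟨i, j, hij, h⟩ := hg
  have hij' : (i : ℕ) < j := hij
  have hj : (j : ℕ) ≤ Nat.card M := Nat.lt_succ_iff.1 j.2
  have hjΩ : (j : ℕ) * Ω ≤ Nat.card M * Ω := Nat.mul_le_mul_right _ hj
  have hiΩ : (i : ℕ) * Ω ≤ (j : ℕ) * Ω := Nat.mul_le_mul_right _ hij'.le
  rw [Nat.add_mul, one_mul] at hs
  have hlen : ((s.drop k).take (i * Ω)).length = i * Ω := by
    rw [List.length_take, List.length_drop]; omega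
  -- the factor between the two positions
  set y := ((s.drop k).drop (i * Ω)).take ((j - i) * Ω) with hy
  have hylen : y.length = Ω * (j - i) := by
    rw [hy, List.length_take, List.length_drop, List.length_drop, Nat.mul_comm Ω, Nat.sub_mul]
    omega
  have hsplit : (s.drop k).take (j * Ω) = (s.drop k).take (i * Ω) ++ y := by
    rw [hy, ← List.take_add, ← Nat.add_mul]
    congr 2; omega
  obtain ⟨f, hf, hfy⟩ := hΩ.exists_length_eq μ (by omega) one_pos hylen
  have hstab : ∀ n, ev μ ((s.drop k).take (i * Ω)) * ev μ f ^ n =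
      ev μ ((s.drop k).take (i * Ω)) := by
    intro n
    induction n with
    | zero => simp
    | succ n ih =>
      conv_rhs => rw [h, hsplit, ev_append, ← hfy]
      rw [pow_succ, ← mul_assoc, ih]
  have hs₁ : s.take (k + i * Ω) = s.take k ++ (s.drop k).take (i * Ω) := List.take_add
  refine ⟨s.take (k + i * Ω), s.drop (k + i * Ω), (List.take_append_drop _ _).symm, ?_, ?_, f, ?_, ?_⟩
  · intro h0
    have := congrArg List.length h0
    rw [List.length_take, List.length_nil] at this
    omega
  · rw [List.length_append, List.length_take, Nat.min_eq_left (by omega), ← add_assoc]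
    exact hk.add (Dvd.intro_left _ rfl)
  · simpa using hf
  · have hwin : (p ++ s.take (k + i * Ω)).rtake (window M Ω) =
        (p ++ s.take k).rtake (window M Ω - i * Ω) ++ (s.drop k).take (i * Ω) := by
      rw [hs₁, ← List.append_assoc, rtake_append, hlen,
        rtake_of_length_le ((s.drop k).take (i * Ω)) (by rw [hlen, window]; omega)]
    rw [hwin, ev_append, mul_assoc, hstab]

/-- The invariant of the scan: `factorisation` is a path to the current stabilising word and has the
value of the prefix `x` cut off so far, and the rest of the word contains no stabilised position. -/
theorem scan_spec (hΩ : IsStable M Ω) (w : List A) :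
    Path Ω [] (factorisation μ Ω w) (scan μ Ω w).1 ∧
    ∃ x, w = x ++ (scan μ Ω w).2 ∧ Ω ∣ x.length ∧
      ev μ (spell Ω (factorisation μ Ω w)) = ev μ x ∧
      ∀ s₁ s₂, (scan μ Ω w).2 = s₁ ++ s₂ → s₁ ≠ [] → ¬ Stabilized μ Ω (x ++ s₁) := by
  induction w using List.reverseRecOn with
  | nil => exact ⟨rfl, [], rfl, by simp, rfl, by simp⟩
  | append_singleton w a ih =>
    obtain ⟨hpath, x, hx, hxd, hxe, hxs⟩ := ih
    have hfac : factorisation μ Ω (w ++ [a]) = factorisation μ Ω w ++ emit μ Ω w a := by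
      simp [factorisation, tagWith_concat]
    by_cases h : Stabilized μ Ω (w ++ [a])
    · have hwa : w ++ [a] = x ++ ((scan μ Ω w).2 ++ [a]) := by
        rw [← List.append_assoc, ← hx]
      have hd : Ω ∣ ((scan μ Ω w).2 ++ [a]).length := by
        have := h.1
        rw [hwa, List.length_append] at this
        exact (Nat.dvd_add_right hxd).1 this
      obtain ⟨h1, h2⟩ := shortRep_spec (μ := μ) hΩ (by simp) hd
      rw [scan_concat_of_stabilized h, hfac, emit, if_pos h]
      refine ⟨hpath.append Ω ⟨rfl, h1, length_stabilizer h, rfl⟩, w ++ [a], by simp, h.1, ?_, ?_⟩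
      · rw [spell_append, ev_append, spell_cons, ev_append, ev_append, h2, ev_powWord, hxe,
          spell_nil, ev_nil, mul_one, ← mul_assoc, ← ev_append, ← hwa, ev_mul_stabilizer h]
      · intro s₁ s₂ hs hs₁
        simp at hs
        exact absurd hs.1 hs₁
    · rw [scan_concat_of_not_stabilized h, hfac, emit, if_neg h, List.append_nil]
      refine ⟨hpath, x, by rw [← List.append_assoc, ← hx], hxd, hxe, ?_⟩
      intro s₁ s₂ hs hs₁
      change (scan μ Ω w).2 ++ [a] = s₁ ++ s₂ at hs
      rcases s₂.eq_nil_or_concat with rfl | ⟨s₂, b, rfl⟩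
      · rw [List.append_nil] at hs
        rw [← hs, ← List.append_assoc, ← hx]
        exact h
      · rw [List.concat_eq_append, ← List.append_assoc] at hs
        exact hxs s₁ s₂ (List.append_inj' hs rfl).1 hs₁

theorem length_scan_le [Finite M] (hΩ : IsStable M Ω) (w : List A) :
    (scan μ Ω w).2.length ≤ (Nat.card M + 1) * Ω := by
  obtain ⟨_, x, -, -, -, h⟩ := scan_spec (μ := μ) hΩ w
  by_contra! hlt
  obtain ⟨s₁, s₂, hs, hs₁, hst⟩ := exists_stabilized (μ := μ) hΩ x _ hlt.le
  exact h s₁ s₂ hs hs₁ hst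

/-- The result of `scan` depends only on a bounded suffix and on the length modulo `Ω`. -/
theorem exists_scan_congr [Finite M] (hΩ : IsStable M Ω) :
    ∃ N, window M Ω ≤ N ∧ ∀ u v : List A, SufEq N Ω u v → scan μ Ω u = scan μ Ω v := by
  refine ⟨window M Ω + (Nat.card M + 1) * Ω, Nat.le_add_right _ _, fun u v huv => ?_⟩
  rcases huv.cases with rfl | ⟨p, p', s, rfl, rfl, hs, hp⟩
  · rfl
  set r := s.take (window M Ω) with hr
  have hrlen : r.length = window M Ω := by rw [hr, List.length_take]; omega
  obtain ⟨s₁, s₂, hs', hs₁, hst⟩ := exists_stabilized (μ := μ) hΩ (p ++ r) (s.drop (window M Ω))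
    (by rw [List.length_drop]; omega)
  rw [← List.take_append_drop (window M Ω) s, ← hr, hs']
  have hlong : ∀ t, SufEq (window M Ω) Ω (p ++ (r ++ t)) (p' ++ (r ++ t)) := fun t =>
    SufEq.append_of_le p p' (by rw [List.length_append]; omega) hp
  rw [List.append_assoc] at hst
  clear hs'
  induction s₂ using List.reverseRecOn with
  | nil =>
    obtain ⟨t, b, rfl⟩ : ∃ t b, s₁ = t ++ [b] := by
      rcases s₁.eq_nil_or_concat with rfl | ⟨t, b, rfl⟩
      · exact absurd rfl hs₁
      · exact ⟨t, b, List.concat_eq_append⟩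
    have hst' := (stabilized_congr (hlong _)).1 hst
    have h := hlong (t ++ [b])
    simp only [← List.append_assoc] at hst hst' h
    simp only [List.append_nil, ← List.append_assoc]
    rw [scan_concat_of_stabilized hst, scan_concat_of_stabilized hst', stabilizer_congr h]
  | append_singleton t b ih =>
    have h := hlong (s₁ ++ t ++ [b])
    simp only [← List.append_assoc] at ih h ⊢
    by_cases hb : Stabilized μ Ω (p ++ r ++ s₁ ++ t ++ [b])
    · have hb' := (stabilized_congr h).1 hb
      rw [scan_concat_of_stabilized hb, scan_concat_of_stabilized hb', stabilizer_congr h]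
    · have hb' := fun hb' => hb ((stabilized_congr h).2 hb')
      rw [scan_concat_of_not_stabilized hb, scan_concat_of_not_stabilized hb', ih]

theorem emit_congr {N : ℕ} (hN : window M Ω ≤ N)
    (h : ∀ u v : List A, SufEq N Ω u v → scan μ Ω u = scan μ Ω v) {u v : List A}
    (huv : SufEq N Ω u v) : emit μ Ω u = emit μ Ω v := by
  funext a
  have h1 : SufEq (window M Ω) Ω (u ++ [a]) (v ++ [a]) := (huv.mono hN dvd_rfl).append [a]
  unfold emit
  rw [h u v huv, stabilizer_congr h1]
  by_cases h2 : Stabilized μ Ω (u ++ [a])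
  · rw [if_pos h2, if_pos ((stabilized_congr h1).1 h2)]
  · rw [if_neg h2, if_neg fun h3 => h2 ((stabilized_congr h1).2 h3)]

end Scan

/-! ### From languages over letters back to words -/

section Lifting

variable {A Λ M : Type} [Monoid M] (μ : A → M) (Ω : ℕ)

/-- The words that can stand for a stabilised position: none, at the beginning of the word, or a
stabilising word of length `Ω`. -/
def IsAnchor (q : List A) : Prop := q = [] ∨ q.length = Ω

/-- The letters that describe a factor between two stabilised positions. -/
def factorLetters (A : Type) (Ω : ℕ) : Set (Letter A) :=
  {l | IsAnchor Ω l.1 ∧ l.2.1.length = Ω ∧ l.2.2.length = Ω}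

/-- The end markers `(q, v, [])` with `|v| ≤ T` for which `G q v` holds. -/
def endMarkers (Ω T : ℕ) (G : List A → List A → Prop) : Set (Letter A) :=
  {l | IsAnchor Ω l.1 ∧ l.2.1.length ≤ T ∧ l.2.2 = [] ∧ G l.1 l.2.1}

/-- The lift of the language `L`: the (codes of the) words of letters, closed by an end marker
allowed by `G`, that describe words of `L`. -/
def lift (code : Letter A → Λ) (T : ℕ) (G : List A → List A → Prop) (L : Set (List A)) :
    Set (List Λ) :=
  {y | ∃ x q v, Path Ω [] x q ∧ v.length ≤ T ∧ G q v ∧ spell Ω x ++ v ∈ L ∧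
    y = x.map code ++ [code (q, v, [])]}

/-- Some word of `L` is described by a word of letters with end marker `(q, v, [])`. -/
def HasEnd (L : Set (List A)) (q v : List A) : Prop :=
  ∃ x, Path Ω [] x q ∧ spell Ω x ++ v ∈ L

/-- The language `L` is recognised by the morphism that extends `μ`. -/
def Recognizes (L : Set (List A)) : Prop := ∀ u v, ev μ u = ev μ v → u ∈ L → v ∈ L

variable {μ Ω}

theorem Path.isAnchor {q q' : List A} {x : List (Letter A)} (h : Path Ω q x q')
    (hq : IsAnchor Ω q) : IsAnchor Ω q' := by
  induction x generalizing q with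
  | nil => cases h; exact hq
  | cons l x ih => exact ih h.2.2.2 (Or.inr h.2.2.1)

theorem Path.mem_factorLetters {q q' : List A} {x : List (Letter A)} (h : Path Ω q x q')
    (hq : IsAnchor Ω q) : ∀ l ∈ x, l ∈ factorLetters A Ω := by
  induction x generalizing q with
  | nil => simp
  | cons l x ih =>
    intro l' hl'
    rcases List.mem_cons.1 hl' with rfl | hl'
    · exact ⟨h.1 ▸ hq, h.2.1, h.2.2.1⟩
    · exact ih h.2.2.2 (Or.inr h.2.2.1) l' hl'

theorem finite_endMarkers [Finite A] (T : ℕ) (G : List A → List A → Prop) :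
    (endMarkers Ω T G).Finite := by
  refine ((List.finite_length_le A Ω).prod
    ((List.finite_length_le A T).prod (Set.finite_singleton []))).subset ?_
  rintro ⟨q, v, f⟩ ⟨h1, h2, h3, -⟩
  refine ⟨?_, h2, h3⟩
  rcases h1 with h | h
  · change q = [] at h; subst h; exact Nat.zero_le _
  · exact h.le

section Expand

open Classical in
/-- A word of length `Ω * d` with the value of `v`, if there is one. -/
noncomputable def longRep (μ : A → M) (Ω d : ℕ) (v : List A) : List A :=
  if h : ∃ w : List A, w.length = Ω * d ∧ ev μ w = ev μ v then h.choose else []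

theorem longRep_spec (hΩ : IsStable M Ω) {d : ℕ} (hd : 0 < d) {v : List A} (hv : v.length = Ω) :
    (longRep μ Ω d v).length = Ω * d ∧ ev μ (longRep μ Ω d v) = ev μ v := by
  have h := hΩ.exists_length_eq μ one_pos hd (hv.trans (mul_one Ω).symm)
  unfold longRep
  rw [dif_pos h]
  exact h.choose_spec

/-- A word with the value of `v f^Ω`, of length a multiple of `d` and with a long power of `f` as a
suffix. -/
noncomputable def expandLetter (μ : A → M) (Ω d m : ℕ) (l : Letter A) : List A :=
  longRep μ Ω d l.2.1 ++ powWord l.2.2 (Ω * (d * m))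

/-- A word with the value of `spell Ω x`, in which each factor is expanded so that classes of `SU`
and `MOD` see nothing but the adjacent letter. -/
noncomputable def expand (μ : A → M) (Ω d m : ℕ) (x : List (Letter A)) : List A :=
  x.flatMap (expandLetter μ Ω d m)

theorem ev_expand (hΩ : IsStable M Ω) {d m : ℕ} (hd : 0 < d) (hm : 0 < m) {q q' : List A}
    {x : List (Letter A)} (h : Path Ω q x q') : ev μ (expand μ Ω d m x) = ev μ (spell Ω x) := by
  induction x generalizing q with
  | nil => rfl
  | cons l x ih =>
    rw [spell_cons, expand, List.flatMap_cons, ev_append, ev_append, ← ih h.2.2.2, expandLetter,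
      ev_append, ev_append, (longRep_spec hΩ hd h.2.1).2, ev_powWord, ev_powWord, pow_mul,
      hΩ.pow_pow _ (Nat.mul_pos hd hm)]
    rfl

theorem length_anchor_modEq {d m : ℕ} {q : List A} :
    (powWord q (Ω * (d * m))).length ≡ 0 [MOD d] := by
  rw [length_powWord]
  exact (Nat.modEq_zero_iff_dvd.2 ⟨Ω * m * q.length, by ring⟩)

theorem sufEq_expandLetter (hΩ : IsStable M Ω) {N d m : ℕ} (hd : 0 < d) (hm : N ≤ m)
    {l : Letter A} (hv : l.2.1.length = Ω) (hf : l.2.2.length = Ω) :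
    SufEq N d (powWord l.1 (Ω * (d * m)) ++ expandLetter μ Ω d m l)
      (powWord l.2.2 (Ω * (d * m))) := by
  rw [expandLetter, ← List.append_assoc]
  have h : SufEq N d ((powWord l.1 (Ω * (d * m)) ++ longRep μ Ω d l.2.1) ++
      powWord l.2.2 (Ω * (d * m))) ([] ++ powWord l.2.2 (Ω * (d * m))) := by
    refine SufEq.append_of_le _ _ ?_ ?_
    · rw [length_powWord, hf]
      have h1 := hΩ.pos
      calc N ≤ m := hm
        _ = 1 * (1 * m) * 1 := by ring
        _ ≤ Ω * (d * m) * Ω := by gcongr <;> omega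
    · rw [List.length_append, (longRep_spec hΩ hd hv).1]
      have h2 : Ω * d ≡ 0 [MOD d] := Nat.modEq_zero_iff_dvd.2 (Dvd.intro_left _ rfl)
      exact length_anchor_modEq.add h2
  exact h

theorem sufEq_expand (hΩ : IsStable M Ω) {N d m : ℕ} (hd : 0 < d) (hm : N ≤ m) {q q' : List A}
    {x : List (Letter A)} (h : Path Ω q x q') :
    SufEq N d (powWord q (Ω * (d * m)) ++ expand μ Ω d m x) (powWord q' (Ω * (d * m))) := by
  induction x generalizing q with
  | nil => cases h; rw [expand, List.flatMap_nil, List.append_nil]; exact SufEq.refl _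
  | cons l x ih =>
    rw [expand, List.flatMap_cons, ← List.append_assoc, ← h.1]
    exact ((sufEq_expandLetter hΩ hd hm h.2.1 h.2.2.1).append _).trans (ih h.2.2.2)

/-- The tagging of `expand x` is the image of `x` under a morphism. -/
theorem tagWith_expand (hΩ : IsStable M Ω) {N d m : ℕ} (hd : 0 < d) (hm : N ≤ m) {Y : Type}
    {κ : List A → A → Y} (hκ : ∀ u v, SufEq N d u v → κ u = κ v) {q q' : List A}
    {x : List (Letter A)} (h : Path Ω q x q') :
    tagWith (fun u => κ (powWord q (Ω * (d * m)) ++ u)) (expand μ Ω d m x) =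
      x.flatMap fun l => tagWith (fun u => κ (powWord l.1 (Ω * (d * m)) ++ u))
        (expandLetter μ Ω d m l) := by
  induction x generalizing q with
  | nil => rfl
  | cons l x ih =>
    rw [expand, List.flatMap_cons, List.flatMap_cons, tagWith_append, ← h.1]
    congr 1
    rw [← ih h.2.2.2, expand]
    have := tagWith_shift_congr hκ (sufEq_expandLetter (μ := μ) hΩ hd hm h.2.1 h.2.2.1)
      (x.flatMap (expandLetter μ Ω d m))
    simpa only [List.append_assoc] using this

end Expand

theorem factorisation_spec [Finite M] (hΩ : IsStable M Ω) {T : ℕ}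
    (hT : (Nat.card M + 1) * Ω ≤ T) {L : Set (List A)} (hL : Recognizes μ L) {w : List A}
    (hw : w ∈ L) :
    Path Ω [] (factorisation μ Ω w) (scan μ Ω w).1 ∧ (scan μ Ω w).2.length ≤ T ∧
      spell Ω (factorisation μ Ω w) ++ (scan μ Ω w).2 ∈ L := by
  obtain ⟨hp, x, hx, -, hev, -⟩ := scan_spec (μ := μ) hΩ w
  refine ⟨hp, (length_scan_le hΩ w).trans hT, hL w _ ?_ hw⟩
  conv_lhs => rw [hx]
  rw [ev_append, ev_append, hev]

variable {C : LanguageClass} [Finite A] [Nonempty A] [Finite Λ] [Nonempty Λ]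

/-- Finitely many languages of `(C ∘ SU) ∘ MOD` can be transferred to languages of `C` over the
new alphabet, as long as only words with a fixed end `(q, v)` matter. The transferred languages do
not look at codes of letters other than `factorLetters`. -/
theorem exists_transfer (hC : IsPositiveVariety C) (hΩ : IsStable M Ω) (μ : A → M)
    {code : Letter A → Λ} (hcode : Set.InjOn code (factorLetters A Ω)) {Ks : Set (Set (List A))}
    (hfin : Ks.Finite) (hKs : ∀ K ∈ Ks, K ∈ enrich (enrich C SU) MOD A) (q v : List A) :
    ∃ (γ : List (Letter A) → List A) (F : Set (List A) → Set (List Λ)),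
      (∀ K ∈ Ks, F K ∈ C Λ) ∧ ∀ x, Path Ω [] x q → ev μ (γ x) = ev μ (spell Ω x) ∧
        ∀ K ∈ Ks, ∀ t : List Λ, (∀ c ∈ t, c ∉ code '' factorLetters A Ω) →
          (x.map code ++ t ∈ F K ↔ γ x ++ v ∈ K) := by
  classical
  choose! N d hd h using fun K hK => exists_tagWith_of_mem_enrich (hKs K hK)
  set N' := ∑ K ∈ hfin.toFinset, N K with hN'
  set d' := ∏ K ∈ hfin.toFinset, d K with hd'
  have hd'pos : 0 < d' := Finset.prod_pos fun K hK => hd K (by simpa using hK)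
  have hNle : ∀ K ∈ Ks, N K ≤ N' := fun K hK =>
    Finset.single_le_sum (f := N) (fun _ _ => Nat.zero_le _) (by simpa using hK)
  have hddvd : ∀ K ∈ Ks, d K ∣ d' := fun K hK => Finset.dvd_prod_of_mem d (by simpa using hK)
  set m := N' + 1 with hm
  have hex : ∀ K ∈ Ks, ∃ F ∈ C Λ, ∀ x, Path Ω [] x q → ∀ t : List Λ,
      (∀ c ∈ t, c ∉ code '' factorLetters A Ω) →
        (x.map code ++ t ∈ F ↔ expand μ Ω d' m x ++ v ∈ K) := by
    intro K hK
    obtain ⟨Y, _, _, κ, F, hκ, hF, hKF⟩ := h K hK (powWord q (Ω * (d' * m)) ++ v)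
    have hκ' : ∀ u v, SufEq N' d' u v → κ u = κ v := fun u v huv =>
      hκ u v (huv.mono (hNle K hK) (hddvd K hK))
    let δ : Letter A → List Y := fun l =>
      tagWith (fun u => κ (powWord l.1 (Ω * (d' * m)) ++ u)) (expandLetter μ Ω d' m l)
    let g : Λ → List Y := fun c =>
      if h : ∃ l ∈ factorLetters A Ω, code l = c then δ h.choose else []
    have hg : ∀ l ∈ factorLetters A Ω, g (code l) = δ l := by
      intro l hl
      have hl' : ∃ l' ∈ factorLetters A Ω, code l' = code l := ⟨l, hl, rfl⟩
      have : g (code l) = δ hl'.choose := dif_pos hl'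
      rw [this, hcode hl'.choose_spec.1 hl hl'.choose_spec.2]
    let z := tagWith (fun u => κ (powWord q (Ω * (d' * m)) ++ u)) v
    refine ⟨_, hC.flatMap_mem g (hC.right_quotient_mem Y F hF z), fun x hx t ht => ?_⟩
    have hsuf := sufEq_expand (μ := μ) hΩ hd'pos (Nat.le_succ N') hx
    rw [powWord_nil, List.nil_append] at hsuf
    have htag := tagWith_expand (μ := μ) hΩ hd'pos (Nat.le_succ N') hκ' hx
    simp only [powWord_nil, List.nil_append] at htag
    rw [hKF _ ((hsuf.mono (hNle K hK) (hddvd K hK)).append v), tagWith_append,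
      tagWith_shift_congr hκ' hsuf]
    have h1 : (x.map code ++ t).flatMap g = x.flatMap δ := by
      have h2 : t.flatMap g = [] := List.flatMap_eq_nil_iff.2 fun c hc =>
        dif_neg fun ⟨l, hl, hlc⟩ => ht c hc ⟨l, hl, hlc⟩
      rw [List.flatMap_append, h2, List.append_nil, List.flatMap_map]
      exact List.flatMap_congr fun l hl => hg l (hx.mem_factorLetters (Or.inl rfl) l hl)
    rw [Set.mem_ofPred_eq, Set.mem_ofPred_eq, h1]
    change x.flatMap δ ++ z ∈ F ↔ tagWith κ (expand μ Ω d' m x) ++ z ∈ F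
    rw [htag]
  choose! F hF hF' using hex
  exact ⟨expand μ Ω d' m, F, hF, fun x hx =>
    ⟨ev_expand hΩ hd'pos (Nat.succ_pos _) hx, fun K hK t ht => hF' K hK x hx t ht⟩⟩

/-- Languages of `C` over the new alphabet pull back to `(C ∘ SU) ∘ MOD` along the factorisation at
stabilised positions; the language may depend on the end of the word. -/
theorem mem_enrich_of_factorisation [Finite M] (hC : IsPositiveVariety C) (hΩ : IsStable M Ω)
    (μ : A → M) (code : Letter A → Λ) {H : List A → List A → Set (List Λ)}
    (hH : ∀ q v, H q v ∈ C Λ) :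
    {w | (factorisation μ Ω w).map code ∈ H (scan μ Ω w).1 (scan μ Ω w).2} ∈
      enrich (enrich C SU) MOD A := by
  obtain ⟨N, hN, hscan⟩ := exists_scan_congr (μ := μ) hΩ
  convert mem_enrich_SU_MOD hC hΩ.pos (φ := fun u a => (emit μ Ω u a).map code)
    (H := fun w => H (scan μ Ω w).1 (scan μ Ω w).2)
    (fun u v huv => by rw [emit_congr hN hscan huv]) (fun u v huv => by rw [hscan u v huv])
    (fun u => hH _ _) using 3
  rw [factorisation, List.map_flatten, map_tagWith]

/-- The end markers that are compatible with all the given languages. The others are irrelevant: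
words with such an end can be covered for free. -/
def commonEnd (Ω : ℕ) (L₁ : Set (List A)) (Ls : Multiset (Set (List A))) (q v : List A) : Prop :=
  HasEnd Ω L₁ q v ∧ ∀ L ∈ Ls, HasEnd Ω L q v

variable {code : Letter A → Λ} {T : ℕ} {L₁ L₂ : Set (List A)} {Ls : Multiset (Set (List A))}

theorem coverable_of_lift [Finite M] (hC : IsPositiveVariety C) (hΩ : IsStable M Ω)
    (hT : (Nat.card M + 1) * Ω ≤ T) (hL₁ : Recognizes μ L₁) (hLs : ∀ L ∈ Ls, Recognizes μ L)
    (h : Coverable C (lift Ω code T (commonEnd Ω L₁ Ls) L₁)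
      (Ls.map (lift Ω code T (commonEnd Ω L₁ Ls)))) :
    Coverable (enrich (enrich C SU) MOD) L₁ Ls := by
  classical
  obtain ⟨Ks, hfin, hKs, hcov, hsep⟩ := h
  set G := commonEnd Ω L₁ Ls with hG
  let HU : Set (List Λ) → List A → List A → Set (List Λ) := fun K q v =>
    if G q v then {y | y ++ [code (q, v, [])] ∈ K} else ∅
  let HW : Set (List A) → List A → List A → Set (List Λ) := fun L q v =>
    if HasEnd Ω L q v then ∅ else Set.univ
  have hHU : ∀ K ∈ Ks, ∀ q v, HU K q v ∈ C Λ := by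
    intro K hK q v
    by_cases hg : G q v
    · have h1 : HU K q v = _ := if_pos hg
      exact h1 ▸ hC.right_quotient_mem Λ K (hKs K hK) _
    · have h1 : HU K q v = _ := if_neg hg
      exact h1 ▸ hC.empty_mem Λ
  have hHW : ∀ L q v, HW L q v ∈ C Λ := by
    intro L q v
    by_cases hg : HasEnd Ω L q v
    · have h1 : HW L q v = _ := if_pos hg
      exact h1 ▸ hC.empty_mem Λ
    · have h1 : HW L q v = _ := if_neg hg
      exact h1 ▸ hC.univ_mem Λ
  let U : Set (List Λ) → Set (List A) := fun K =>
    {w | (factorisation μ Ω w).map code ∈ HU K (scan μ Ω w).1 (scan μ Ω w).2}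
  let W : Set (List A) → Set (List A) := fun L =>
    {w | (factorisation μ Ω w).map code ∈ HW L (scan μ Ω w).1 (scan μ Ω w).2}
  refine ⟨U '' Ks ∪ W '' {L | L ∈ Ls},
    (hfin.image U).union (Set.Finite.image W (Multiset.finite_toSet Ls)), ?_, ?_, ?_⟩
  · rintro _ (⟨K, hK, rfl⟩ | ⟨L, hL, rfl⟩)
    · exact mem_enrich_of_factorisation hC hΩ μ code (hHU K hK)
    · exact mem_enrich_of_factorisation hC hΩ μ code (hHW L)
  · intro w hw
    obtain ⟨h1, h2, h3⟩ := factorisation_spec hΩ hT hL₁ hw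
    by_cases hg : G (scan μ Ω w).1 (scan μ Ω w).2
    · obtain ⟨K, hK, hmem⟩ := hcov ⟨_, _, _, h1, h2, hg, h3, rfl⟩
      have h4 : HU K (scan μ Ω w).1 (scan μ Ω w).2 = _ := if_pos hg
      refine ⟨U K, Or.inl ⟨K, hK, rfl⟩, ?_⟩
      rw [Set.mem_ofPred_eq, h4]
      exact hmem
    · have : ∃ L ∈ Ls, ¬ HasEnd Ω L (scan μ Ω w).1 (scan μ Ω w).2 := by
        by_contra! hcon
        exact hg ⟨⟨_, h1, h3⟩, hcon⟩
      obtain ⟨L, hL, hend⟩ := this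
      have h4 : HW L (scan μ Ω w).1 (scan μ Ω w).2 = _ := if_neg hend
      refine ⟨W L, Or.inr ⟨L, hL, rfl⟩, ?_⟩
      rw [Set.mem_ofPred_eq, h4]
      trivial
  · rintro _ (⟨K, hK, rfl⟩ | ⟨L, hL, rfl⟩)
    · obtain ⟨L', hL', hdisj⟩ := hsep K hK
      obtain ⟨L, hL, rfl⟩ := Multiset.mem_map.1 hL'
      refine ⟨L, hL, Set.eq_empty_of_forall_notMem ?_⟩
      rintro w ⟨hw, hwL⟩
      obtain ⟨h1, h2, h3⟩ := factorisation_spec hΩ hT (hLs L hL) hwL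
      rw [Set.mem_ofPred_eq] at hw
      by_cases hg : G (scan μ Ω w).1 (scan μ Ω w).2
      · have h4 : HU K (scan μ Ω w).1 (scan μ Ω w).2 = _ := if_pos hg
        rw [h4] at hw
        exact Set.eq_empty_iff_forall_notMem.1 hdisj _ ⟨hw, ⟨_, _, _, h1, h2, hg, h3, rfl⟩⟩
      · have h4 : HU K (scan μ Ω w).1 (scan μ Ω w).2 = _ := if_neg hg
        rw [h4] at hw
        exact hw
    · refine ⟨L, hL, Set.eq_empty_of_forall_notMem ?_⟩
      rintro w ⟨hw, hwL⟩
      obtain ⟨h1, h2, h3⟩ := factorisation_spec hΩ hT (hLs L hL) hwL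
      have h4 : HW L (scan μ Ω w).1 (scan μ Ω w).2 = _ := if_pos ⟨_, h1, h3⟩
      rw [Set.mem_ofPred_eq, h4] at hw
      exact hw

theorem separable_of_lift [Finite M] (hC : IsPositiveVariety C) (hΩ : IsStable M Ω)
    (hT : (Nat.card M + 1) * Ω ≤ T) (hL₁ : Recognizes μ L₁) (hL₂ : Recognizes μ L₂)
    (h : Separable C (lift Ω code T (commonEnd Ω L₁ {L₂}) L₁)
      (lift Ω code T (commonEnd Ω L₁ {L₂}) L₂)) :
    Separable (enrich (enrich C SU) MOD) L₁ L₂ := by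
  classical
  obtain ⟨K, hK, hsub, hdisj⟩ := h
  set G := commonEnd Ω L₁ {L₂} with hG
  let H : List A → List A → Set (List Λ) := fun q v =>
    if G q v then {y | y ++ [code (q, v, [])] ∈ K} else {_y | ¬ HasEnd Ω L₂ q v}
  have hpos : ∀ {q v}, G q v → H q v = {y | y ++ [code (q, v, [])] ∈ K} := fun h => if_pos h
  have hneg : ∀ {q v}, ¬ G q v → H q v = {_y | ¬ HasEnd Ω L₂ q v} := fun h => if_neg h
  have hH : ∀ q v, H q v ∈ C Λ := by
    intro q v
    by_cases hg : G q v
    · rw [hpos hg]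
      exact hC.right_quotient_mem Λ K hK _
    · rw [hneg hg]
      by_cases he : HasEnd Ω L₂ q v
      · convert hC.empty_mem Λ
        exact Set.eq_empty_of_forall_notMem fun y hy => hy he
      · convert hC.univ_mem Λ
        exact Set.eq_univ_of_forall fun y => he
  refine ⟨_, mem_enrich_of_factorisation hC hΩ μ code hH, ?_, ?_⟩
  · intro w hw
    obtain ⟨h1, h2, h3⟩ := factorisation_spec hΩ hT hL₁ hw
    rw [Set.mem_ofPred_eq]
    by_cases hg : G (scan μ Ω w).1 (scan μ Ω w).2
    · rw [hpos hg]
      exact hsub ⟨_, _, _, h1, h2, hg, h3, rfl⟩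
    · rw [hneg hg]
      refine fun hend => hg ⟨⟨_, h1, h3⟩, fun L hL => ?_⟩
      rw [Multiset.mem_singleton.1 hL]
      exact hend
  · refine Set.eq_empty_of_forall_notMem ?_
    rintro w ⟨hwL, hw⟩
    obtain ⟨h1, h2, h3⟩ := factorisation_spec hΩ hT hL₂ hwL
    rw [Set.mem_ofPred_eq] at hw
    by_cases hg : G (scan μ Ω w).1 (scan μ Ω w).2
    · rw [hpos hg] at hw
      exact Set.eq_empty_iff_forall_notMem.1 hdisj _ ⟨⟨_, _, _, h1, h2, hg, h3, rfl⟩, hw⟩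
    · rw [hneg hg] at hw
      exact hw ⟨_, h1, h3⟩

theorem lift_coverable (hC : IsPositiveVariety C) (hΩ : IsStable M Ω)
    (hcode : Set.InjOn code (factorLetters A Ω ∪ endMarkers Ω T (commonEnd Ω L₁ Ls)))
    (hL₁ : Recognizes μ L₁) (hLs : ∀ L ∈ Ls, Recognizes μ L)
    (h : Coverable (enrich (enrich C SU) MOD) L₁ Ls) :
    Coverable C (lift Ω code T (commonEnd Ω L₁ Ls) L₁)
      (Ls.map (lift Ω code T (commonEnd Ω L₁ Ls))) := by
  classical
  obtain ⟨Ks, hfin, hKs, hcov, hsep⟩ := h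
  set G := commonEnd Ω L₁ Ls with hG
  choose γ F hF hγ using exists_transfer hC hΩ μ (hcode.mono Set.subset_union_left) hfin hKs
  have hanchor : ∀ {q v}, G q v → IsAnchor Ω q := fun hg => by
    obtain ⟨x, hx, -⟩ := hg.1
    exact hx.isAnchor (Or.inl rfl)
  have hmark : ∀ {q v}, v.length ≤ T → G q v → (q, v, []) ∈ endMarkers Ω T G := fun hv hg =>
    ⟨hanchor hg, hv, rfl, hg⟩
  have hnot : ∀ {l}, l ∈ endMarkers Ω T G → code l ∉ code '' factorLetters A Ω := by
    rintro l hl ⟨l', hl', he⟩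
    rw [hcode (Or.inl hl') (Or.inr hl) he] at hl'
    have h1 := hl'.2.2
    rw [hl.2.2.1] at h1
    exact hΩ.pos.ne h1
  by_cases hend : ∃ q v, v.length ≤ T ∧ G q v
  swap
  · push Not at hend
    refine ⟨∅, Set.finite_empty, by simp, ?_, by simp⟩
    rintro _ ⟨x, q, v, -, hv, hg, -⟩
    exact absurd hg (hend q v hv)
  by_cases htriv : ∃ (B : Type) (_ : Finite B) (_ : Nonempty B), ∃ L ∈ C B, L ≠ ∅ ∧ L ≠ Set.univ
  · obtain ⟨B, _, _, L, hL, hne, hnu⟩ := htriv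
    choose! H hHC hH using fun l (hl : l ∈ endMarkers Ω T G) =>
      hC.exists_marker_test hL hne hnu (Set.mem_image_of_mem code hl)
    refine ⟨(fun p : Letter A × Set (List A) => F p.1.1 p.1.2.1 p.2 ∩ H p.1) ''
      (endMarkers Ω T G ×ˢ Ks), ((finite_endMarkers T G).prod hfin).image _, ?_, ?_, ?_⟩
    · rintro _ ⟨⟨l, K⟩, ⟨hl, hK⟩, rfl⟩
      exact hC.inter_mem Λ _ (hF _ _ K hK) _ (hHC l hl)
    · rintro _ ⟨x, q, v, hx, hv, hg, hmem, rfl⟩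
      have hl := hmark hv hg
      obtain ⟨hev, hγ'⟩ := hγ q v x hx
      have hmem' : γ q v x ++ v ∈ L₁ :=
        hL₁ _ _ (by rw [ev_append, ev_append, hev]) hmem
      obtain ⟨K, hK, hwK⟩ := hcov hmem'
      refine ⟨_, ⟨⟨(q, v, []), K⟩, ⟨hl, hK⟩, rfl⟩, ?_, ?_⟩
      · exact (hγ' K hK _ (by simpa using hnot hl)).2 hwK
      · refine (hH _ hl _ ?_ _ (Set.mem_image_of_mem code hl)).2 rfl
        intro c hc ⟨l', hl', he⟩
        obtain ⟨l, hlx, rfl⟩ := List.mem_map.1 hc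
        exact hnot hl' ⟨l, hx.mem_factorLetters (Or.inl rfl) l hlx, he.symm⟩
    · rintro _ ⟨⟨l, K⟩, ⟨hl, hK⟩, rfl⟩
      obtain ⟨L, hL, hdisj⟩ := hsep K hK
      refine ⟨_, Multiset.mem_map_of_mem _ hL, Set.eq_empty_of_forall_notMem ?_⟩
      rintro _ ⟨⟨hyF, hyH⟩, x, q, v, hx, hv, hg, hmem, rfl⟩
      have hl' := hmark hv hg
      have hll := (hH l hl _ (fun c hc ⟨l', hl', he⟩ => by
        obtain ⟨l, hlx, rfl⟩ := List.mem_map.1 hc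
        exact hnot hl' ⟨l, hx.mem_factorLetters (Or.inl rfl) l hlx, he.symm⟩) _
        (Set.mem_image_of_mem code hl')).1 hyH
      have hll' := hcode (Or.inr hl') (Or.inr hl) hll
      subst hll'
      obtain ⟨hev, hγ'⟩ := hγ q v x hx
      have hwK := (hγ' K hK _ (by simpa using hnot hl')).1 hyF
      exact Set.eq_empty_iff_forall_notMem.1 hdisj _ ⟨hwK, hLs L hL _ _ (by rw [ev_append, ev_append, hev]) hmem⟩
  · -- All languages of `C` are trivial, so that an end common to all languages excludes a cover.
    push Not at htriv
    exfalso
    obtain ⟨q, v, hv, ⟨x₁, hx₁, hmem₁⟩, hg⟩ := hend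
    obtain ⟨hev₁, hγ₁⟩ := hγ q v x₁ hx₁
    obtain ⟨K, hK, hwK⟩ := hcov (hL₁ _ (γ q v x₁ ++ v) (by rw [ev_append, ev_append, hev₁]) hmem₁)
    have hy := (hγ₁ K hK [] (by simp)).2 hwK
    have huniv := htriv Λ inferInstance inferInstance _ (hF q v K hK)
      ⟨_, hy⟩
    obtain ⟨L, hL, hdisj⟩ := hsep K hK
    obtain ⟨x₂, hx₂, hmem₂⟩ := hg L hL
    obtain ⟨hev₂, hγ₂⟩ := hγ q v x₂ hx₂
    have hwK₂ := (hγ₂ K hK [] (by simp)).1 (huniv ▸ Set.mem_univ _)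
    exact Set.eq_empty_iff_forall_notMem.1 hdisj _ ⟨hwK₂, hLs L hL _ _ (by rw [ev_append, ev_append, hev₂]) hmem₂⟩

end Lifting

section SeparationFromCovering

variable {C : LanguageClass} {A : Type} [Finite A] [Nonempty A] {L₁ L₂ : Set (List A)}

theorem Separable.coverable (h : Separable C L₁ L₂) : Coverable C L₁ {L₂} := by
  obtain ⟨K, hK, h1, h2⟩ := h
  refine ⟨{K}, Set.finite_singleton K, by simpa using hK, by simpa using h1, ?_⟩
  rintro _ rfl
  exact ⟨L₂, by simp, by rw [Set.inter_comm]; exact h2⟩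

theorem Coverable.separable (hC : IsPositiveVariety C) (h : Coverable C L₁ {L₂}) :
    Separable C L₁ L₂ := by
  obtain ⟨Ks, hfin, hKs, hcov, hsep⟩ := h
  refine ⟨⋃ K ∈ Ks, K, hC.biUnion_mem hfin hKs, by rwa [← Set.sUnion_eq_biUnion], ?_⟩
  refine Set.eq_empty_of_forall_notMem ?_
  rintro w ⟨hw, hwK⟩
  obtain ⟨K, hK, hwK⟩ := Set.mem_iUnion₂.1 hwK
  obtain ⟨L, hL, hdisj⟩ := hsep K hK
  rw [Multiset.mem_singleton.1 hL] at hdisj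
  exact Set.eq_empty_iff_forall_notMem.1 hdisj _ ⟨hwK, hw⟩

end SeparationFromCovering

/-! ### Running automata given by their descriptions -/

section Run

/-- The list of the states that are reached from a state in `S` by reading `w` with the transitions
in `T`. -/
def run (T : List (ℕ × ℕ × ℕ)) (S : List ℕ) (w : List ℕ) : List ℕ :=
  w.foldl (fun S a => (T.filter fun t => t.1 ∈ S ∧ t.2.1 = a).map fun t => t.2.2) S

/-- Reading `w` from some state in `S` can lead to a final state. -/
def AccFrom (c : NFACode) (S w : List ℕ) : Prop := ∃ p ∈ run c.1 S w, p ∈ c.2.2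

instance (c : NFACode) (S w : List ℕ) : Decidable (AccFrom c S w) :=
  inferInstanceAs (Decidable (∃ p ∈ run c.1 S w, p ∈ c.2.2))

variable {T : List (ℕ × ℕ × ℕ)} {S : List ℕ} {p p' : ℕ}

@[simp] theorem run_nil : run T S [] = S := rfl

theorem run_append (u v : List ℕ) : run T S (u ++ v) = run T (run T S u) v := by
  simp [run, List.foldl_append]

theorem mem_run_cons {a : ℕ} {w : List ℕ} :
    p' ∈ run T S (a :: w) ↔ p' ∈ run T ((T.filter fun t => t.1 ∈ S ∧ t.2.1 = a).map fun t => t.2.2) w :=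
  Iff.rfl

theorem mem_step {a : ℕ} : p' ∈ ((T.filter fun t => t.1 ∈ S ∧ t.2.1 = a).map fun t => t.2.2) ↔
    ∃ p ∈ S, (p, a, p') ∈ T := by
  simp only [List.mem_map, List.mem_filter, decide_eq_true_eq, Prod.exists]
  constructor
  · rintro ⟨p, a', _, ⟨h, hp, rfl⟩, rfl⟩
    exact ⟨p, hp, h⟩
  · rintro ⟨p, hp, h⟩
    exact ⟨p, a, p', ⟨h, hp, rfl⟩, rfl⟩

theorem mem_run_iff_exists {w : List ℕ} : p' ∈ run T S w ↔ ∃ p ∈ S, p' ∈ run T [p] w := by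
  induction w generalizing S with
  | nil => simp
  | cons a w ih =>
    rw [mem_run_cons, ih]
    constructor
    · rintro ⟨r, hr, h⟩
      obtain ⟨p, hp, hpr⟩ := mem_step.1 hr
      exact ⟨p, hp, mem_run_cons.2 (ih.2 ⟨r, mem_step.2 ⟨p, by simp, hpr⟩, h⟩)⟩
    · rintro ⟨p, hp, h⟩
      obtain ⟨r, hr, h⟩ := ih.1 (mem_run_cons.1 h)
      obtain ⟨p₁, hp₁, hpr⟩ := mem_step.1 hr
      rw [List.mem_singleton.1 hp₁] at hpr
      exact ⟨r, mem_step.2 ⟨p, hp, hpr⟩, h⟩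

theorem mem_run_singleton_cons {a : ℕ} {w : List ℕ} :
    p' ∈ run T [p] (a :: w) ↔ ∃ r, (p, a, r) ∈ T ∧ p' ∈ run T [r] w := by
  rw [mem_run_cons, mem_run_iff_exists]
  constructor
  · rintro ⟨r, hr, h⟩
    obtain ⟨p₁, hp₁, hpr⟩ := mem_step.1 hr
    rw [List.mem_singleton.1 hp₁] at hpr
    exact ⟨r, hpr, h⟩
  · rintro ⟨r, hr, h⟩
    exact ⟨r, mem_step.2 ⟨p, by simp, hr⟩, h⟩

theorem mem_run_singleton_append {u v : List ℕ} :
    p' ∈ run T [p] (u ++ v) ↔ ∃ r ∈ run T [p] u, p' ∈ run T [r] v := by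
  rw [run_append, mem_run_iff_exists]

theorem lt_of_mem_run {B : ℕ} (hT : ∀ t ∈ T, t.2.2 < B) (hp : p < B) {w : List ℕ}
    (h : p' ∈ run T [p] w) : p' < B := by
  induction w generalizing p with
  | nil => rwa [List.mem_singleton.1 h]
  | cons a w ih =>
    obtain ⟨r, hr, h⟩ := mem_run_singleton_cons.1 h
    exact ih (hT _ hr) h

theorem accFrom_iff_exists {c : NFACode} {w : List ℕ} :
    AccFrom c S w ↔ ∃ p ∈ S, AccFrom c [p] w := by
  unfold AccFrom
  constructor
  · rintro ⟨p', h, hp'⟩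
    obtain ⟨p, hp, h⟩ := mem_run_iff_exists.1 h
    exact ⟨p, hp, p', h, hp'⟩
  · rintro ⟨p, hp, p', h, hp'⟩
    exact ⟨p', mem_run_iff_exists.2 ⟨p, hp, h⟩, hp'⟩

theorem accFrom_append {c : NFACode} {u v : List ℕ} :
    AccFrom c [p] (u ++ v) ↔ ∃ r ∈ run c.1 [p] u, AccFrom c [r] v := by
  unfold AccFrom
  simp only [mem_run_singleton_append]
  constructor
  · rintro ⟨p', ⟨r, hr, h⟩, hp'⟩; exact ⟨r, hr, p', h, hp'⟩
  · rintro ⟨r, hr, p', h, hp'⟩; exact ⟨p', ⟨r, hr, h⟩, hp'⟩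

/-- A word over `Fin (k + 1)` as a word of natural numbers. -/
def natWord {k : ℕ} (w : List (Fin (k + 1))) : List ℕ := w.map Fin.val

theorem natWord_injective {k : ℕ} :
    Function.Injective (natWord : List (Fin (k + 1)) → List ℕ) :=
  List.map_injective_iff.2 Fin.val_injective

@[simp] theorem natWord_append {k : ℕ} (u v : List (Fin (k + 1))) :
    natWord (u ++ v) = natWord u ++ natWord v := List.map_append

@[simp] theorem length_natWord {k : ℕ} (u : List (Fin (k + 1))) :
    (natWord u).length = u.length := List.length_map _

@[simp] theorem natWord_eq_nil {k : ℕ} {u : List (Fin (k + 1))} : natWord u = [] ↔ u = [] :=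
  List.map_eq_nil_iff

theorem natWord_powWord {k : ℕ} (f : List (Fin (k + 1))) (n : ℕ) :
    natWord (powWord f n) = powWord (natWord f) n := by
  simp [natWord, powWord, List.map_flatten, List.map_replicate]

theorem mem_evalFrom_iff {k : ℕ} (c : NFACode) (S : List ℕ) (w : List (Fin (k + 1))) :
    p ∈ (c.toNFA k).evalFrom {q | q ∈ S} w ↔ p ∈ run c.1 S (natWord w) := by
  induction w generalizing S with
  | nil => simp [natWord]
  | cons a w ih =>
    have hstep : (c.toNFA k).stepSet {q | q ∈ S} a =
        {q | q ∈ (c.1.filter fun t => t.1 ∈ S ∧ t.2.1 = (a : ℕ)).map fun t => t.2.2} := by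
      ext r
      rw [NFA.mem_stepSet, Set.mem_ofPred_eq, mem_step]
      rfl
    rw [NFA.evalFrom_cons, hstep, ih]
    rfl

theorem mem_language_iff {k : ℕ} (c : NFACode) (w : List (Fin (k + 1))) :
    w ∈ c.language k ↔ AccFrom c c.2.1 (natWord w) := by
  have h : w ∈ c.language k ↔ ∃ p ∈ (c.toNFA k).accept, p ∈ (c.toNFA k).evalFrom
      (c.toNFA k).start w := Iff.rfl
  rw [h]
  constructor
  · rintro ⟨p, hp, h⟩
    exact ⟨p, (mem_evalFrom_iff c _ w).1 h, hp⟩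
  · rintro ⟨p, h, hp⟩
    exact ⟨p, hp, (mem_evalFrom_iff c _ w).2 h⟩

end Run

/-! ### The transition monoid -/

section TransitionMonoid

/-- All states of `c` are smaller than `B`. -/
def StatesLT (B : ℕ) (c : NFACode) : Prop :=
  (∀ t ∈ c.1, t.1 < B ∧ t.2.2 < B) ∧ ∀ p ∈ c.2.1, p < B

/-- A monoid that recognises the languages of `B` automata with states smaller than `B`. An element
gives, for each automaton, a map that sends a set of states to the set of states from which it can
be reached. -/
abbrev TransMonoid (B : ℕ) : Type := Fin B → Function.End (Set (Fin B))

instance (B : ℕ) : Finite (Function.End (Set (Fin B))) :=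
  inferInstanceAs (Finite (Set (Fin B) → Set (Fin B)))

theorem card_transMonoid (B : ℕ) :
    Nat.card (TransMonoid B) = ((2 ^ B) ^ (2 ^ B)) ^ B := by
  have h : Nat.card (Fin B → Set (Fin B) → Set (Fin B)) = ((2 ^ B) ^ (2 ^ B)) ^ B := by
    simp [Nat.card_eq_fintype_card]
  exact h

theorem card_set_transMonoid (B : ℕ) :
    Nat.card (Set (TransMonoid B)) = 2 ^ ((2 ^ B) ^ (2 ^ B)) ^ B := by
  have := Fintype.ofFinite (TransMonoid B)
  rw [← card_transMonoid, Nat.card_eq_fintype_card, Nat.card_eq_fintype_card, Fintype.card_set]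

/-- The action of the letters on the states of the automata in `cs`. -/
def transLetter (B : ℕ) (cs : List NFACode) {k : ℕ} (a : Fin (k + 1)) : TransMonoid B :=
  fun j X => {p | ∃ p' ∈ X, ((p : ℕ), (a : ℕ), (p' : ℕ)) ∈ (cs.getD j ([], [], [])).1}

theorem mem_ev_transLetter {B k : ℕ} {cs : List NFACode} {j : Fin B}
    (hc : StatesLT B (cs.getD j ([], [], []))) (w : List (Fin (k + 1))) (X : Set (Fin B))
    (p : Fin B) : p ∈ (ev (transLetter B cs) w j : Set (Fin B) → Set (Fin B)) X ↔
      ∃ p' ∈ X, (p' : ℕ) ∈ run (cs.getD j ([], [], [])).1 [(p : ℕ)] (natWord w) := by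
  induction w generalizing p with
  | nil =>
    have h : (ev (transLetter B cs) ([] : List (Fin (k + 1))) j : Set (Fin B) → Set (Fin B)) X = X :=
      rfl
    rw [h]
    simp [natWord, ← Fin.ext_iff]
  | cons a w ih =>
    have h : (ev (transLetter B cs) (a :: w) j : Set (Fin B) → Set (Fin B)) X =
        (transLetter B cs a j : Set (Fin B) → Set (Fin B))
          ((ev (transLetter B cs) w j : Set (Fin B) → Set (Fin B)) X) := by
      rw [show a :: w = [a] ++ w from rfl, ev_append]
      have h' : ev (transLetter B cs) [a] = transLetter B cs a := by simp [ev]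
      rw [h']
      rfl
    rw [h]
    constructor
    · rintro ⟨r, hr, hpr⟩
      obtain ⟨p', hp', h⟩ := (ih r).1 hr
      exact ⟨p', hp', mem_run_singleton_cons.2 ⟨r, hpr, h⟩⟩
    · rintro ⟨p', hp', h⟩
      obtain ⟨r, hpr, h⟩ := mem_run_singleton_cons.1 h
      exact ⟨⟨r, (hc.1 _ hpr).2⟩, (ih ⟨r, _⟩).2 ⟨p', hp', h⟩, hpr⟩

theorem recognizes_language {B k : ℕ} {cs : List NFACode} (hlen : cs.length ≤ B)
    (hcs : ∀ c ∈ cs, StatesLT B c) {c : NFACode} (hc : c ∈ cs) :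
    Recognizes (transLetter B cs) (c.language k) := by
  obtain ⟨j, hj, rfl⟩ := List.getElem_of_mem hc
  have hget : cs.getD j ([], [], []) = cs[j] := List.getD_eq_getElem _ _ hj
  have hc' := hcs _ hc
  set c := cs[j] with hcj
  have key : ∀ w : List (Fin (k + 1)), w ∈ c.language k ↔ ∃ p : Fin B, (p : ℕ) ∈ c.2.1 ∧
      p ∈ (ev (transLetter B cs) w ⟨j, hj.trans_le hlen⟩ : Set (Fin B) → Set (Fin B))
        {p' | (p' : ℕ) ∈ c.2.2} := by
    intro w
    rw [mem_language_iff, accFrom_iff_exists]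
    constructor
    · rintro ⟨p, hp, p', hp', h⟩
      refine ⟨⟨p, hc'.2 p hp⟩, hp, (mem_ev_transLetter ?_ w _ _).2 ?_⟩
      · simpa only [hget] using hc'
      · simp only [hget]
        exact ⟨⟨p', lt_of_mem_run (fun t ht => (hc'.1 t ht).2) (hc'.2 p hp) hp'⟩, h, hp'⟩
    · rintro ⟨p, hp, h⟩
      have h' := (mem_ev_transLetter (by simpa only [hget] using hc') w _ _).1 h
      simp only [hget] at h'
      obtain ⟨p', h1, h2⟩ := h'
      exact ⟨p, hp, p', h2, h1⟩
  intro u v huv hu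
  rw [key] at hu ⊢
  rwa [← huv]

end TransitionMonoid

/-! ### Computing the reduction -/

section Reduction

/-- The words of length `n` with letters at most `k`. -/
def wordsOfLength (k n : ℕ) : List (List ℕ) :=
  Nat.rec [[]] (fun _ ws => ws.flatMap fun w => (List.range (k + 1)).map fun a => a :: w) n

/-- The words of length at most `n` with letters at most `k`. -/
def wordsUpTo (k n : ℕ) : List (List ℕ) := (List.range (n + 1)).flatMap (wordsOfLength k)

/-- A strict bound on the states and an upper bound on the number of the automata in `cs`: since
numbers, pairs and lists are encoded monotonically, a code of `cs` will do. -/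
def bound (cs : List NFACode) : ℕ := Encodable.encode cs + 1

/-- The order of `TransMonoid B`. -/
def monoidOrder (B : ℕ) : ℕ := ((2 ^ B) ^ (2 ^ B)) ^ B

/-- A stability exponent of the transition monoid. -/
def exponent (cs : List NFACode) : ℕ := (2 ^ monoidOrder (bound cs)).factorial

/-- A bound on the length of the part of a word after its last stabilised position. -/
def tailBound (cs : List NFACode) : ℕ := (monoidOrder (bound cs) + 1) * exponent cs

/-- The letters in `factorLetters`. -/
def factorList (k Ω : ℕ) : List (Letter ℕ) :=
  ([] :: wordsOfLength k Ω).flatMap fun q => (wordsOfLength k Ω).flatMap fun v =>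
    (wordsOfLength k Ω).map fun f => (q, v, f)

/-- A bounded search that decides `HasEnd`, see `hasEnd_iff`. -/
def SearchEnd (k Ω : ℕ) (c : NFACode) (q v : List ℕ) : Prop :=
  ∃ u ∈ (if q = [] then [[]] else wordsOfLength k Ω), AccFrom c c.2.1 (u ++ powWord q Ω ++ v)

instance (k Ω : ℕ) (c : NFACode) (q v : List ℕ) : Decidable (SearchEnd k Ω c q v) :=
  inferInstanceAs (Decidable (∃ _ ∈ _, _))

/-- The end markers compatible with all automata in `cs`. -/
def markerList (k : ℕ) (cs : List NFACode) : List (Letter ℕ) :=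
  (([] :: wordsOfLength k (exponent cs)).flatMap fun q =>
    (wordsUpTo k (tailBound cs)).map fun v => (q, v, [])).filter
      fun l => ∀ c ∈ cs, SearchEnd k (exponent cs) c l.1 l.2.1

/-- The largest letter of the new alphabet: an upper bound on the codes of all letters that are
used. -/
def newSize (k : ℕ) (cs : List NFACode) : ℕ :=
  Encodable.encode (factorList k (exponent cs) ++ markerList k cs)

/-- The state of the lifted automaton that stores the anchor `q` and the state `p`. The number `0`
is left for the final state. -/
def pairState (q : List ℕ) (p : ℕ) : ℕ := Encodable.encode (q, p) + 1

/-- The automaton for the lift of the language of `c`. -/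
def liftCode (k : ℕ) (cs : List NFACode) (c : NFACode) : NFACode :=
  (((factorList k (exponent cs)).flatMap fun l => (List.range (bound cs)).flatMap fun p =>
      (run c.1 [p] (l.2.1 ++ powWord l.2.2 (exponent cs))).map fun p' =>
        (pairState l.1 p, Encodable.encode l, pairState l.2.2 p')) ++
    ((markerList k cs).flatMap fun l =>
      ((List.range (bound cs)).filter fun p => AccFrom c [p] l.2.1).map fun p =>
        (pairState l.1 p, Encodable.encode l, 0)),
    c.2.1.map (pairState []), [0])

/-! ### Correctness of the computation -/

theorem mem_wordsOfLength {k n : ℕ} {w : List ℕ} :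
    w ∈ wordsOfLength k n ↔ ∃ u : List (Fin (k + 1)), u.length = n ∧ natWord u = w := by
  induction n generalizing w with
  | zero =>
    change w ∈ [[]] ↔ _
    rw [List.mem_singleton]
    constructor
    · rintro rfl
      exact ⟨[], rfl, rfl⟩
    · rintro ⟨u, hu, rfl⟩
      rw [List.length_eq_zero_iff.1 hu]
      rfl
  | succ n ih =>
    change w ∈ (wordsOfLength k n).flatMap (fun w => (List.range (k + 1)).map fun a => a :: w) ↔ _
    simp only [List.mem_flatMap, List.mem_map, List.mem_range]
    constructor
    · rintro ⟨w', hw', a, ha, rfl⟩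
      obtain ⟨u, hu, rfl⟩ := ih.1 hw'
      exact ⟨⟨a, ha⟩ :: u, by simp [hu], rfl⟩
    · rintro ⟨u, hu, rfl⟩
      obtain ⟨a, u, rfl⟩ := List.exists_cons_of_length_eq_add_one hu
      exact ⟨natWord u, ih.2 ⟨u, by simpa using hu, rfl⟩, a, a.2, rfl⟩

theorem mem_wordsUpTo {k n : ℕ} {w : List ℕ} :
    w ∈ wordsUpTo k n ↔ ∃ u : List (Fin (k + 1)), u.length ≤ n ∧ natWord u = w := by
  simp only [wordsUpTo, List.mem_flatMap, List.mem_range, mem_wordsOfLength, Nat.lt_succ_iff]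
  constructor
  · rintro ⟨m, hm, u, rfl, h⟩
    exact ⟨u, hm, h⟩
  · rintro ⟨u, hu, h⟩
    exact ⟨_, hu, u, rfl, h⟩

theorem encode_le_encode_of_mem {α : Type} [Encodable α] {a : α} {l : List α} (h : a ∈ l) :
    Encodable.encode a < Encodable.encode l := by
  induction l with
  | nil => simp at h
  | cons b l ih =>
    rw [Encodable.encode_list_cons, Nat.lt_succ_iff]
    rcases List.mem_cons.1 h with rfl | h
    · exact Nat.left_le_pair _ _
    · exact (ih h).le.trans (Nat.right_le_pair _ _)

theorem statesLT_bound {cs : List NFACode} {c : NFACode} (hc : c ∈ cs) :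
    StatesLT (bound cs) c := by
  have h : Encodable.encode c < bound cs := (encode_le_encode_of_mem hc).trans (Nat.lt_succ_self _)
  obtain ⟨T, S, F⟩ := c
  rw [Encodable.encode_prod_val, Encodable.encode_prod_val] at h
  have hT : Encodable.encode T < bound cs := (Nat.left_le_pair _ _).trans_lt h
  have hS : Encodable.encode S < bound cs :=
    ((Nat.left_le_pair _ _).trans (Nat.right_le_pair _ _)).trans_lt h
  refine ⟨fun t ht => ?_, fun p hp => ?_⟩
  · have h' := (encode_le_encode_of_mem ht).trans hT
    obtain ⟨p, a, r⟩ := t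
    rw [Encodable.encode_prod_val, Encodable.encode_prod_val] at h'
    exact ⟨(Nat.left_le_pair _ _).trans_lt h',
      ((Nat.right_le_pair _ _).trans (Nat.right_le_pair _ _)).trans_lt h'⟩
  · exact (encode_le_encode_of_mem hp).trans hS

theorem length_le_bound (cs : List NFACode) : cs.length ≤ bound cs := by
  unfold bound
  induction cs with
  | nil => simp
  | cons c cs ih =>
    rw [Encodable.encode_list_cons, List.length_cons]
    have := Nat.right_le_pair (Encodable.encode c) (Encodable.encode cs)
    omega

theorem isStable_exponent (cs : List NFACode) :
    IsStable (TransMonoid (bound cs)) (exponent cs) := by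
  have h := isStable_factorial (TransMonoid (bound cs))
  rwa [card_set_transMonoid] at h

theorem card_mul_exponent (cs : List NFACode) :
    (Nat.card (TransMonoid (bound cs)) + 1) * exponent cs ≤ tailBound cs := by
  rw [card_transMonoid]
  rfl

theorem Path.length_spell {A : Type} {Ω : ℕ} {q q' : List A} {x : List (Letter A)}
    (h : Path Ω q x q') : Ω ∣ (spell Ω x).length := by
  induction x generalizing q with
  | nil => simp
  | cons l x ih =>
    rw [spell_cons, List.length_append, List.length_append, length_powWord, h.2.1]
    exact ((dvd_refl _).add (Dvd.intro _ rfl)).add (ih h.2.2.2)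

/-- Consecutive factors can be merged, so that a single factor suffices to test `HasEnd`. -/
theorem hasEnd_iff {A M : Type} [Monoid M] {μ : A → M} {Ω : ℕ} (hΩ : IsStable M Ω)
    {L : Set (List A)} (hL : Recognizes μ L) {q v : List A} (hq : IsAnchor Ω q) :
    HasEnd Ω L q v ↔ ∃ u : List A, (if q = [] then u = [] else u.length = Ω) ∧
      u ++ powWord q Ω ++ v ∈ L := by
  classical
  constructor
  · rintro ⟨x, hx, hmem⟩
    rcases x.eq_nil_or_concat with rfl | ⟨x, l, rfl⟩
    · cases hx
      exact ⟨[], by simp, by simpa using hmem⟩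
    · rw [List.concat_eq_append] at hx hmem
      have hsplit : ∀ {q₀ : List A} {x : List (Letter A)}, Path Ω q₀ (x ++ [l]) q →
          ∃ q₁, Path Ω q₀ x q₁ ∧ Path Ω q₁ [l] q := by
        intro q₀ x
        induction x generalizing q₀ with
        | nil => exact fun h => ⟨q₀, rfl, h⟩
        | cons l' x ih =>
          intro h
          obtain ⟨q₁, h1, h2⟩ := ih h.2.2.2
          exact ⟨q₁, ⟨h.1, h.2.1, h.2.2.1, h1⟩, h2⟩
      obtain ⟨q₁, h1, h2, h3, h4, h5⟩ := hsplit hx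
      have h5' : l.2.2 = q := h5
      have hqne : q ≠ [] := by
        rintro rfl
        rw [h5'] at h4
        exact hΩ.pos.ne h4
      have hne : spell Ω x ++ l.2.1 ≠ [] := by
        intro h0
        rw [List.append_eq_nil_iff] at h0
        rw [h0.2] at h3
        exact hΩ.pos.ne h3
      have hd : Ω ∣ (spell Ω x ++ l.2.1).length := by
        rw [List.length_append, h3]
        exact h1.length_spell.add dvd_rfl
      obtain ⟨h6, h7⟩ := shortRep_spec (μ := μ) hΩ hne hd
      refine ⟨_, by rw [if_neg hqne]; exact h6, hL _ _ ?_ hmem⟩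
      rw [spell_append, spell_cons, spell_nil, List.append_nil, h5']
      simp only [ev_append, h7, mul_assoc]
  · rintro ⟨u, hu, hmem⟩
    by_cases hq0 : q = []
    · subst hq0
      rw [if_pos rfl] at hu
      subst hu
      exact ⟨[], rfl, by simpa using hmem⟩
    · rw [if_neg hq0] at hu
      exact ⟨[([], u, q)], ⟨rfl, hu, hq.resolve_left hq0, rfl⟩, by simpa [spell] using hmem⟩

theorem searchEnd_iff {k : ℕ} {cs : List NFACode} {c : NFACode} (hc : c ∈ cs)
    {q v : List (Fin (k + 1))} (hq : IsAnchor (exponent cs) q) :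
    SearchEnd k (exponent cs) c (natWord q) (natWord v) ↔
      HasEnd (exponent cs) (c.language k) q v := by
  rw [hasEnd_iff (isStable_exponent cs) (recognizes_language (length_le_bound cs)
    (fun c hc => statesLT_bound hc) hc) hq]
  unfold SearchEnd
  simp only [natWord_eq_nil, mem_language_iff, natWord_append, natWord_powWord]
  constructor
  · rintro ⟨u, hu, h⟩
    by_cases hq0 : q = []
    · rw [if_pos hq0, List.mem_singleton] at hu
      exact ⟨[], by rw [if_pos hq0], by simpa [hu, natWord] using h⟩
    · rw [if_neg hq0, mem_wordsOfLength] at hu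
      obtain ⟨u, hu, rfl⟩ := hu
      exact ⟨u, by rwa [if_neg hq0], h⟩
  · rintro ⟨u, hu, h⟩
    refine ⟨natWord u, ?_, h⟩
    by_cases hq0 : q = []
    · rw [if_pos hq0] at hu ⊢
      simpa using hu
    · rw [if_neg hq0] at hu ⊢
      exact mem_wordsOfLength.2 ⟨u, hu, rfl⟩

/-- A letter over `Fin (k + 1)` as a letter over `ℕ`. -/
def natLetter {k : ℕ} (l : Letter (Fin (k + 1))) : Letter ℕ :=
  (natWord l.1, natWord l.2.1, natWord l.2.2)

theorem natLetter_injective {k : ℕ} :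
    Function.Injective (natLetter : Letter (Fin (k + 1)) → Letter ℕ) := by
  rintro ⟨q, v, f⟩ ⟨q', v', f'⟩ h
  simp only [natLetter, Prod.mk.injEq] at h
  rw [natWord_injective h.1, natWord_injective h.2.1, natWord_injective h.2.2]

theorem mem_anchors {k Ω : ℕ} {w : List ℕ} : w ∈ [] :: wordsOfLength k Ω ↔
    ∃ q : List (Fin (k + 1)), IsAnchor Ω q ∧ natWord q = w := by
  rw [List.mem_cons, mem_wordsOfLength]
  constructor
  · rintro (rfl | ⟨q, hq, rfl⟩)
    · exact ⟨[], Or.inl rfl, rfl⟩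
    · exact ⟨q, Or.inr hq, rfl⟩
  · rintro ⟨q, rfl | hq, rfl⟩
    · exact Or.inl rfl
    · exact Or.inr ⟨q, hq, rfl⟩

theorem mem_factorList {k Ω : ℕ} {l : Letter ℕ} :
    l ∈ factorList k Ω ↔ ∃ l' ∈ factorLetters (Fin (k + 1)) Ω, natLetter l' = l := by
  unfold factorList
  rw [List.mem_flatMap]
  simp only [List.mem_flatMap, List.mem_map]
  constructor
  · rintro ⟨q, hq, v, hv, f, hf, rfl⟩
    obtain ⟨q, hq', rfl⟩ := mem_anchors.1 hq
    obtain ⟨v, hv', rfl⟩ := mem_wordsOfLength.1 hv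
    obtain ⟨f, hf', rfl⟩ := mem_wordsOfLength.1 hf
    exact ⟨(q, v, f), ⟨hq', hv', hf'⟩, rfl⟩
  · rintro ⟨⟨q, v, f⟩, ⟨hq, hv, hf⟩, rfl⟩
    exact ⟨_, mem_anchors.2 ⟨q, hq, rfl⟩, _, mem_wordsOfLength.2 ⟨v, hv, rfl⟩, _,
      mem_wordsOfLength.2 ⟨f, hf, rfl⟩, rfl⟩

theorem mem_markerList {k : ℕ} {cs : List NFACode} {l : Letter ℕ} :
    l ∈ markerList k cs ↔ ∃ l' ∈ endMarkers (exponent cs) (tailBound cs)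
      (fun q v => ∀ c ∈ cs, HasEnd (exponent cs) (c.language k) q v), natLetter l' = l := by
  unfold markerList
  rw [List.mem_filter, List.mem_flatMap]
  simp only [List.mem_map, decide_eq_true_eq]
  constructor
  · rintro ⟨⟨q, hq, v, hv, rfl⟩, h⟩
    obtain ⟨q, hq', rfl⟩ := mem_anchors.1 hq
    obtain ⟨v, hv', rfl⟩ := mem_wordsUpTo.1 hv
    exact ⟨(q, v, []), ⟨hq', hv', rfl, fun c hc => (searchEnd_iff hc hq').1 (h c hc)⟩, rfl⟩
  · rintro ⟨⟨q, v, f⟩, ⟨hq, hv, hf, h⟩, rfl⟩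
    change f = [] at hf
    subst hf
    exact ⟨⟨_, mem_anchors.2 ⟨q, hq, rfl⟩, _, mem_wordsUpTo.2 ⟨v, hv, rfl⟩, rfl⟩,
      fun c hc => (searchEnd_iff hc hq).2 (h c hc)⟩

/-- The letter of the new alphabet `Fin (n + 1)` that stands for `l`. -/
def newLetter (n : ℕ) {k : ℕ} (l : Letter (Fin (k + 1))) : Fin (n + 1) :=
  Fin.ofNat (n + 1) (Encodable.encode (natLetter l))

section Correctness

variable {k : ℕ} {cs : List NFACode} {G : List (Fin (k + 1)) → List (Fin (k + 1)) → Prop}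

theorem mem_endMarkers_iff (hG : ∀ q v, G q v ↔ ∀ c ∈ cs, HasEnd (exponent cs) (c.language k) q v)
    {l : Letter ℕ} : l ∈ markerList k cs ↔
      ∃ l' ∈ endMarkers (exponent cs) (tailBound cs) G, natLetter l' = l := by
  rw [mem_markerList]
  simp only [endMarkers, hG]

theorem newLetter_val (hG : ∀ q v, G q v ↔ ∀ c ∈ cs, HasEnd (exponent cs) (c.language k) q v)
    {l : Letter (Fin (k + 1))} (hl : l ∈ factorLetters (Fin (k + 1)) (exponent cs) ∪
      endMarkers (exponent cs) (tailBound cs) G) :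
    (newLetter (newSize k cs) l : ℕ) = Encodable.encode (natLetter l) := by
  refine Nat.mod_eq_of_lt (Nat.lt_succ_of_lt (encode_le_encode_of_mem ?_))
  rw [List.mem_append]
  rcases hl with hl | hl
  · exact Or.inl (mem_factorList.2 ⟨l, hl, rfl⟩)
  · exact Or.inr ((mem_endMarkers_iff hG).2 ⟨l, hl, rfl⟩)

theorem newLetter_injOn (hG : ∀ q v, G q v ↔ ∀ c ∈ cs, HasEnd (exponent cs) (c.language k) q v) :
    Set.InjOn (newLetter (newSize k cs)) (factorLetters (Fin (k + 1)) (exponent cs) ∪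
      endMarkers (exponent cs) (tailBound cs) G) := by
  intro l hl l' hl' h
  have := congrArg Fin.val h
  rw [newLetter_val hG hl, newLetter_val hG hl'] at this
  exact natLetter_injective (Encodable.encode_injective this)

theorem pairState_inj {q q' : List ℕ} {p p' : ℕ} (h : pairState q p = pairState q' p') :
    q = q' ∧ p = p' :=
  Prod.ext_iff.1 (Encodable.encode_injective (Nat.succ_injective h))

/-- The transitions of the lifted automaton. -/
theorem mem_liftCode_iff {c : NFACode} {s a r : ℕ} : (s, a, r) ∈ (liftCode k cs c).1 ↔
    (∃ l ∈ factorList k (exponent cs), ∃ p < bound cs,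
      ∃ p' ∈ run c.1 [p] (l.2.1 ++ powWord l.2.2 (exponent cs)),
        s = pairState l.1 p ∧ a = Encodable.encode l ∧ r = pairState l.2.2 p') ∨
    ∃ l ∈ markerList k cs, ∃ p < bound cs, AccFrom c [p] l.2.1 ∧
      s = pairState l.1 p ∧ a = Encodable.encode l ∧ r = 0 := by
  simp only [liftCode, List.mem_append, List.mem_flatMap, List.mem_range, List.mem_map,
    List.mem_filter, decide_eq_true_eq, Prod.mk.injEq, @eq_comm _ s, @eq_comm _ a, @eq_comm _ r,
    and_assoc]

theorem zero_mem_run_zero {c : NFACode} {y : List ℕ} :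
    0 ∈ run (liftCode k cs c).1 [0] y ↔ y = [] := by
  cases y with
  | nil => simp
  | cons a y =>
    simp only [reduceCtorEq, iff_false, mem_run_singleton_cons]
    rintro ⟨r, hr, -⟩
    rcases mem_liftCode_iff.1 hr with ⟨l, _, p, _, p', _, h, _⟩ | ⟨l, _, p, _, _, h, _⟩ <;>
      exact absurd h (Nat.succ_ne_zero _).symm

theorem zero_mem_run_pairState
    (hG : ∀ q v, G q v ↔ ∀ c ∈ cs, HasEnd (exponent cs) (c.language k) q v) {c : NFACode}
    (hc : c ∈ cs) {q : List (Fin (k + 1))} {p : ℕ} (hq : IsAnchor (exponent cs) q)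
    (hp : p < bound cs) (y : List (Fin (newSize k cs + 1))) :
    0 ∈ run (liftCode k cs c).1 [pairState (natWord q) p] (natWord y) ↔
      ∃ x q' v, Path (exponent cs) q x q' ∧ v.length ≤ tailBound cs ∧ G q' v ∧
        AccFrom c [p] (natWord (spell (exponent cs) x ++ v)) ∧
        y = x.map (newLetter (newSize k cs)) ++ [newLetter (newSize k cs) (q', v, [])] := by
  induction y generalizing q p with
  | nil =>
    constructor
    · intro h
      exact absurd (List.mem_singleton.1 h) (Nat.succ_ne_zero _).symm
    · rintro ⟨x, q', v, -, -, -, -, h⟩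
      simp at h
  | cons b y ih =>
    change 0 ∈ run _ _ ((b : ℕ) :: natWord y) ↔ _
    rw [mem_run_singleton_cons]
    constructor
    · rintro ⟨r, hr, h0⟩
      rcases mem_liftCode_iff.1 hr with ⟨l, hl₀, p₁, _, p', hp', hs, ha, rfl⟩ |
        ⟨l, hl₀, p₁, _, hacc, hs, ha, rfl⟩
      · obtain ⟨l, hl, rfl⟩ := mem_factorList.1 hl₀
        obtain ⟨hq₁, rfl⟩ := pairState_inj hs
        have hq₁ := natWord_injective hq₁
        have hpB : p' < bound cs :=
          lt_of_mem_run (fun t ht => ((statesLT_bound hc).1 t ht).2) hp hp'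
        obtain ⟨x, q', v, hx, hv, hg, hacc, rfl⟩ := (ih (Or.inr hl.2.2) hpB).1 h0
        refine ⟨l :: x, q', v, ⟨hq₁.symm, hl.2.1, hl.2.2, hx⟩, hv, hg, ?_, ?_⟩
        · rw [spell_cons, List.append_assoc, natWord_append, accFrom_append, natWord_append,
            natWord_powWord]
          exact ⟨p', hp', hacc⟩
        · rw [List.map_cons, List.cons_append]
          congr 1
          exact Fin.ext (ha.trans (newLetter_val hG (Or.inl hl)).symm)
      · obtain ⟨⟨q', v, f⟩, hl, rfl⟩ := (mem_endMarkers_iff hG).1 hl₀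
        obtain ⟨hq₁, rfl⟩ := pairState_inj hs
        have hq₁ := natWord_injective hq₁
        have hf : f = [] := hl.2.2.1
        subst hf
        have hy := natWord_eq_nil.1 (zero_mem_run_zero.1 h0)
        subst hy
        refine ⟨[], q', v, hq₁, hl.2.1, hl.2.2.2, hacc, ?_⟩
        rw [List.map_nil, List.nil_append]
        congr 1
        exact Fin.ext (ha.trans (newLetter_val hG (Or.inr hl)).symm)
    · rintro ⟨x, q', v, hx, hv, hg, hacc, hy⟩
      cases x with
      | nil =>
        cases hx
        rw [List.map_nil, List.nil_append, List.cons.injEq] at hy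
        obtain ⟨rfl, rfl⟩ := hy
        have hl : (q, v, []) ∈ endMarkers (exponent cs) (tailBound cs) G := ⟨hq, hv, rfl, hg⟩
        refine ⟨0, mem_liftCode_iff.2 (Or.inr ⟨natLetter (q, v, []),
          (mem_endMarkers_iff hG).2 ⟨_, hl, rfl⟩, p, hp, hacc, rfl,
          newLetter_val hG (Or.inr hl), rfl⟩), zero_mem_run_zero.2 rfl⟩
      | cons l x =>
        rw [List.map_cons, List.cons_append, List.cons.injEq] at hy
        obtain ⟨rfl, rfl⟩ := hy
        obtain ⟨rfl, h1, h2, h3⟩ := hx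
        have hl : l ∈ factorLetters (Fin (k + 1)) (exponent cs) := ⟨hq, h1, h2⟩
        rw [spell_cons, List.append_assoc, natWord_append, accFrom_append, natWord_append,
          natWord_powWord] at hacc
        obtain ⟨p', hp', hacc⟩ := hacc
        have hpB : p' < bound cs :=
          lt_of_mem_run (fun t ht => ((statesLT_bound hc).1 t ht).2) hp hp'
        exact ⟨pairState (natWord l.2.2) p', mem_liftCode_iff.2 (Or.inl ⟨natLetter l,
          mem_factorList.2 ⟨l, hl, rfl⟩, p, hp, p', hp', rfl, newLetter_val hG (Or.inl hl), rfl⟩),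
          (ih (Or.inr h2) hpB).2 ⟨x, q', v, h3, hv, hg, hacc, rfl⟩⟩

theorem language_liftCode
    (hG : ∀ q v, G q v ↔ ∀ c ∈ cs, HasEnd (exponent cs) (c.language k) q v) {c : NFACode}
    (hc : c ∈ cs) : (liftCode k cs c).language (newSize k cs) =
      lift (exponent cs) (newLetter (newSize k cs)) (tailBound cs) G (c.language k) := by
  ext y
  have hstart : y ∈ (liftCode k cs c).language (newSize k cs) ↔
      ∃ p ∈ c.2.1, 0 ∈ run (liftCode k cs c).1 [pairState [] p] (natWord y) := by
    rw [mem_language_iff, accFrom_iff_exists]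
    simp [liftCode, AccFrom]
  have hlift : ∀ w, w ∈ c.language k ↔ ∃ p ∈ c.2.1, AccFrom c [p] (natWord w) := fun w => by
    rw [mem_language_iff, accFrom_iff_exists]
  rw [hstart]
  constructor
  · rintro ⟨p, hp, h⟩
    obtain ⟨x, q, v, hx, hv, hg, hacc, rfl⟩ :=
      (zero_mem_run_pairState hG hc (q := []) (Or.inl rfl) ((statesLT_bound hc).2 p hp) y).1 h
    exact ⟨x, q, v, hx, hv, hg, (hlift _).2 ⟨p, hp, hacc⟩, rfl⟩
  · rintro ⟨x, q, v, hx, hv, hg, hmem, rfl⟩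
    obtain ⟨p, hp, hacc⟩ := (hlift _).1 hmem
    exact ⟨p, hp, (zero_mem_run_pairState hG hc (q := []) (Or.inl rfl)
      ((statesLT_bound hc).2 p hp) _).2 ⟨x, q, v, hx, hv, hg, hacc, rfl⟩⟩

end Correctness

end Reduction

/-! ### Computability of the reduction -/

section Computability

variable {α : Type} [Primcodable α]

theorem primrecRel_mem : PrimrecRel fun (a : α) (l : List α) => a ∈ l :=
  ((PrimrecRel.exists_mem_list Primrec.eq).swap).of_eq fun a l => by
    simp [Function.swap]

theorem primrec_run : Primrec fun x : List (ℕ × ℕ × ℕ) × List ℕ × List ℕ => run x.1 x.2.1 x.2.2 := by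
  have hR : PrimrecRel fun (t : ℕ × ℕ × ℕ) (x : List ℕ × ℕ) => t.1 ∈ x.1 ∧ t.2.1 = x.2 := by
    refine PrimrecPred.and ?_ ?_
    · exact primrecRel_mem.comp (Primrec.fst.comp Primrec.fst) (Primrec.fst.comp Primrec.snd)
    · exact Primrec.eq.comp (Primrec.fst.comp (Primrec.snd.comp Primrec.fst))
        (Primrec.snd.comp Primrec.snd)
  have hstep : Primrec₂ fun (x : List (ℕ × ℕ × ℕ) × List ℕ × List ℕ) (y : List ℕ × ℕ) =>
      (x.1.filter fun t => t.1 ∈ y.1 ∧ t.2.1 = y.2).map fun t => t.2.2 := by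
    refine Primrec.list_map ?_ (Primrec.snd.comp (Primrec.snd.comp Primrec.snd)).to₂
    exact hR.listFilter.comp (Primrec.fst.comp Primrec.fst) Primrec.snd
  exact Primrec.list_foldl (Primrec.snd.comp Primrec.snd) (Primrec.fst.comp Primrec.snd) hstep

theorem primrecPred_accFrom :
    PrimrecPred fun x : NFACode × List ℕ × List ℕ => AccFrom x.1 x.2.1 x.2.2 := by
  have h : PrimrecRel fun (l : List ℕ) (l' : List ℕ) => ∃ p ∈ l, p ∈ l' :=
    primrecRel_mem.exists_mem_list
  exact h.comp (primrec_run.comp ((Primrec.fst.comp Primrec.fst).pair Primrec.snd))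
    (Primrec.snd.comp (Primrec.snd.comp Primrec.fst))

theorem primrec_powWord : Primrec₂ fun (f : List ℕ) (n : ℕ) => powWord f n := by
  have h : Primrec₂ fun (f : List ℕ) (n : ℕ) =>
      (Nat.rec [] (fun _ w => f ++ w) n : List ℕ) :=
    Primrec.nat_rec (Primrec.const [])
      (Primrec.list_append.comp Primrec.fst (Primrec.snd.comp Primrec.snd)).to₂
  refine h.of_eq fun f n => ?_
  induction n with
  | zero => rfl
  | succ n ih => rw [powWord_succ, ← ih]

theorem primrec_wordsOfLength : Primrec₂ wordsOfLength := by
  have hcons : Primrec₂ fun (k : ℕ) (w : List ℕ) => (List.range (k + 1)).map fun a => a :: w :=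
    Primrec.list_map (Primrec.list_range.comp (Primrec.succ.comp Primrec.fst))
      (Primrec.list_cons.comp Primrec.snd (Primrec.snd.comp Primrec.fst))
  have hstep : Primrec₂ fun (k : ℕ) (y : ℕ × List (List ℕ)) =>
      y.2.flatMap fun w => (List.range (k + 1)).map fun a => a :: w :=
    Primrec.list_flatMap (Primrec.snd.comp Primrec.snd)
      (hcons.comp (Primrec.fst.comp Primrec.fst) Primrec.snd)
  exact Primrec.nat_rec (f := fun _ : ℕ => [([] : List ℕ)]) (Primrec.const _) hstep

theorem primrec_wordsUpTo : Primrec₂ wordsUpTo := by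
  refine Primrec.list_flatMap (Primrec.list_range.comp (Primrec.succ.comp Primrec.snd)) ?_
  exact primrec_wordsOfLength.comp (Primrec.fst.comp Primrec.fst) Primrec.snd

theorem primrec_pow : Primrec₂ fun a b : ℕ => a ^ b := Primrec₂.unpaired'.1 Nat.Primrec.pow

theorem primrec_factorial : Primrec Nat.factorial := by
  have h : Primrec fun n : ℕ => (Nat.rec 1 (fun n m => (n + 1) * m) n : ℕ) :=
    Primrec.nat_rec₁ 1 (Primrec.nat_mul.comp (Primrec.succ.comp Primrec.fst) Primrec.snd).to₂
  refine h.of_eq fun n => ?_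
  induction n with
  | zero => rfl
  | succ n ih => rw [Nat.factorial_succ, ← ih]

theorem primrec_monoidOrder_bound : Primrec fun cs => monoidOrder (bound cs) := by
  have hb : Primrec bound := Primrec.succ.comp Primrec.encode
  have h2 : Primrec fun cs => 2 ^ bound cs := primrec_pow.comp (Primrec.const 2) hb
  exact primrec_pow.comp (primrec_pow.comp h2 h2) hb

theorem primrec_exponent : Primrec exponent :=
  primrec_factorial.comp (primrec_pow.comp (Primrec.const 2) primrec_monoidOrder_bound)

theorem primrec_tailBound : Primrec tailBound :=
  Primrec.nat_mul.comp (Primrec.succ.comp primrec_monoidOrder_bound) primrec_exponent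

theorem primrec_anchors : Primrec₂ fun k Ω : ℕ => [] :: wordsOfLength k Ω :=
  Primrec.list_cons.comp₂ (Primrec₂.const []) primrec_wordsOfLength

theorem primrec_factorList : Primrec₂ factorList := by
  refine Primrec.list_flatMap primrec_anchors ?_
  refine Primrec.list_flatMap (primrec_wordsOfLength.comp (Primrec.fst.comp Primrec.fst)
    (Primrec.snd.comp Primrec.fst)) ?_
  refine Primrec.list_map (primrec_wordsOfLength.comp
    (Primrec.fst.comp (Primrec.fst.comp Primrec.fst))
    (Primrec.snd.comp (Primrec.fst.comp Primrec.fst))) ?_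
  exact (Primrec.snd.comp (Primrec.fst.comp Primrec.fst)).pair
    ((Primrec.snd.comp Primrec.fst).pair Primrec.snd)

theorem primrecRel_searchEnd : PrimrecRel fun (c : NFACode) (x : (ℕ × ℕ) × List ℕ × List ℕ) =>
    SearchEnd x.1.1 x.1.2 c x.2.1 x.2.2 := by
  have hacc : PrimrecRel fun (u : List ℕ) (y : NFACode × (ℕ × ℕ) × List ℕ × List ℕ) =>
      AccFrom y.1 y.1.2.1 (u ++ powWord y.2.2.1 y.2.1.2 ++ y.2.2.2) := by
    have hc : Primrec fun z : List ℕ × NFACode × (ℕ × ℕ) × List ℕ × List ℕ => z.2.1 :=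
      Primrec.fst.comp Primrec.snd
    have hx : Primrec fun z : List ℕ × NFACode × (ℕ × ℕ) × List ℕ × List ℕ => z.2.2 :=
      Primrec.snd.comp Primrec.snd
    have hw : Primrec fun z : List ℕ × NFACode × (ℕ × ℕ) × List ℕ × List ℕ =>
        z.1 ++ powWord z.2.2.2.1 z.2.2.1.2 ++ z.2.2.2.2 :=
      Primrec.list_append.comp (Primrec.list_append.comp Primrec.fst (primrec_powWord.comp
      (Primrec.fst.comp (Primrec.snd.comp hx)) (Primrec.snd.comp (Primrec.fst.comp hx))))
      (Primrec.snd.comp (Primrec.snd.comp hx))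
    exact primrecPred_accFrom.comp (hc.pair ((Primrec.fst.comp (Primrec.snd.comp hc)).pair hw))
  have hlist : Primrec fun y : NFACode × (ℕ × ℕ) × List ℕ × List ℕ =>
      if y.2.2.1 = [] then [[]] else wordsOfLength y.2.1.1 y.2.1.2 := by
    have hx : Primrec fun y : NFACode × (ℕ × ℕ) × List ℕ × List ℕ => y.2 := Primrec.snd
    exact Primrec.ite (Primrec.eq.comp (Primrec.fst.comp (Primrec.snd.comp hx)) (Primrec.const []))
      (Primrec.const _) (primrec_wordsOfLength.comp (Primrec.fst.comp (Primrec.fst.comp hx))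
        (Primrec.snd.comp (Primrec.fst.comp hx)))
  exact hacc.exists_mem_list.comp hlist Primrec.id

theorem primrec_markerList : Primrec₂ markerList := by
  have hall : PrimrecRel fun (l : Letter ℕ) (x : ℕ × List NFACode) =>
      ∀ c ∈ x.2, SearchEnd x.1 (exponent x.2) c l.1 l.2.1 := by
    have hx : Primrec fun z : Letter ℕ × ℕ × List NFACode => z.2 := Primrec.snd
    refine primrecRel_searchEnd.forall_mem_list.comp (Primrec.snd.comp hx) ?_
      (f := fun z : Letter ℕ × ℕ × List NFACode => z.2.2)
      (g := fun z : Letter ℕ × ℕ × List NFACode =>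
        ((z.2.1, exponent z.2.2), z.1.1, z.1.2.1))
    exact ((Primrec.fst.comp hx).pair (primrec_exponent.comp (Primrec.snd.comp hx))).pair
      ((Primrec.fst.comp Primrec.fst).pair (Primrec.fst.comp (Primrec.snd.comp Primrec.fst)))
  refine hall.listFilter.comp ?_ Primrec.id
  refine Primrec.list_flatMap (primrec_anchors.comp Primrec.fst
    (primrec_exponent.comp Primrec.snd)) ?_
  refine Primrec.list_map (primrec_wordsUpTo.comp (Primrec.fst.comp Primrec.fst)
    (primrec_tailBound.comp (Primrec.snd.comp Primrec.fst))) ?_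
  exact (Primrec.snd.comp Primrec.fst).pair (Primrec.snd.pair (Primrec.const []))

theorem primrec_newSize : Primrec₂ newSize :=
  Primrec.encode.comp (Primrec.list_append.comp
    (primrec_factorList.comp Primrec.fst (primrec_exponent.comp Primrec.snd)) primrec_markerList)

theorem primrec_pairState : Primrec₂ pairState :=
  Primrec.succ.comp (Primrec.encode.comp Primrec.id)

theorem primrec_liftCode :
    Primrec₂ fun (x : ℕ × List NFACode) (c : NFACode) => liftCode x.1 x.2 c := by
  have hk : Primrec fun z : (ℕ × List NFACode) × NFACode => z.1.1 :=
    Primrec.fst.comp Primrec.fst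
  have hcs : Primrec fun z : (ℕ × List NFACode) × NFACode => z.1.2 :=
    Primrec.snd.comp Primrec.fst
  have hc : Primrec fun z : (ℕ × List NFACode) × NFACode => z.2 := Primrec.snd
  have hrange : Primrec fun z : (ℕ × List NFACode) × NFACode => List.range (bound z.1.2) :=
    Primrec.list_range.comp (Primrec.succ.comp (Primrec.encode.comp hcs))
  unfold liftCode
  refine (Primrec.list_append.comp ?_ ?_).pair
    ((Primrec.list_map (Primrec.fst.comp (Primrec.snd.comp hc)) ?_).pair (Primrec.const [0]))
  · refine Primrec.list_flatMap (primrec_factorList.comp hk (primrec_exponent.comp hcs)) ?_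
    refine Primrec.list_flatMap (hrange.comp Primrec.fst) ?_
    have hz : Primrec fun y : (((ℕ × List NFACode) × NFACode) × Letter ℕ) × ℕ => y.1.1 :=
      Primrec.fst.comp Primrec.fst
    have hl : Primrec fun y : (((ℕ × List NFACode) × NFACode) × Letter ℕ) × ℕ => y.1.2 :=
      Primrec.snd.comp Primrec.fst
    have hw : Primrec fun y : (((ℕ × List NFACode) × NFACode) × Letter ℕ) × ℕ =>
        y.1.2.2.1 ++ powWord y.1.2.2.2 (exponent y.1.1.1.2) :=
      Primrec.list_append.comp (Primrec.fst.comp (Primrec.snd.comp hl))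
        (primrec_powWord.comp (Primrec.snd.comp (Primrec.snd.comp hl))
          (primrec_exponent.comp (hcs.comp hz)))
    have hrun := primrec_run.comp ((Primrec.fst.comp (hc.comp hz)).pair
      ((Primrec.list_cons.comp Primrec.snd (Primrec.const [])).pair hw))
    refine Primrec.list_map hrun ?_
    have hl' := hl.comp (Primrec.fst (β := ℕ))
    exact (primrec_pairState.comp (Primrec.fst.comp hl')
        (Primrec.snd.comp Primrec.fst)).pair ((Primrec.encode.comp hl').pair
          (primrec_pairState.comp (Primrec.snd.comp (Primrec.snd.comp hl')) Primrec.snd))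
  · refine Primrec.list_flatMap (primrec_markerList.comp hk hcs) ?_
    refine Primrec.list_map ?_ ?_
    · have hR : PrimrecRel fun (p : ℕ) (y : ((ℕ × List NFACode) × NFACode) × Letter ℕ) =>
          AccFrom y.1.2 [p] y.2.2.1 :=
        primrecPred_accFrom.comp ((hc.comp (Primrec.fst.comp Primrec.snd)).pair
          ((Primrec.list_cons.comp Primrec.fst (Primrec.const [])).pair
            (Primrec.fst.comp (Primrec.snd.comp (Primrec.snd.comp Primrec.snd)))))
      exact hR.listFilter.comp (hrange.comp Primrec.fst) Primrec.id
    · have hl : Primrec fun y : (((ℕ × List NFACode) × NFACode) × Letter ℕ) × ℕ => y.1.2 :=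
        Primrec.snd.comp Primrec.fst
      exact (primrec_pairState.comp (Primrec.fst.comp hl) Primrec.snd).pair
        ((Primrec.encode.comp hl).pair (Primrec.const 0))
  · exact primrec_pairState.comp (Primrec.const []) Primrec.snd

/-- The reduction of the covering problem for `(C ∘ SU) ∘ MOD` to the one for `C`. -/
def coveringReduction (x : ℕ × NFACode × List NFACode) : ℕ × NFACode × List NFACode :=
  (newSize x.1 (x.2.1 :: x.2.2), liftCode x.1 (x.2.1 :: x.2.2) x.2.1,
    x.2.2.map (liftCode x.1 (x.2.1 :: x.2.2)))

/-- The reduction of the separation problem for `(C ∘ SU) ∘ MOD` to the one for `C`. -/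
def separationReduction (x : ℕ × NFACode × NFACode) : ℕ × NFACode × NFACode :=
  (newSize x.1 [x.2.1, x.2.2], liftCode x.1 [x.2.1, x.2.2] x.2.1,
    liftCode x.1 [x.2.1, x.2.2] x.2.2)

theorem primrec_coveringReduction : Primrec coveringReduction := by
  have hk : Primrec fun x : ℕ × NFACode × List NFACode => x.1 := Primrec.fst
  have hc : Primrec fun x : ℕ × NFACode × List NFACode => x.2.1 := Primrec.fst.comp Primrec.snd
  have hl : Primrec fun x : ℕ × NFACode × List NFACode => x.2.2 := Primrec.snd.comp Primrec.snd
  have hcs : Primrec fun x : ℕ × NFACode × List NFACode => x.2.1 :: x.2.2 :=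
    Primrec.list_cons.comp hc hl
  have hx := hk.pair hcs
  have h₁ : Primrec fun x : ℕ × NFACode × List NFACode => newSize x.1 (x.2.1 :: x.2.2) :=
    primrec_newSize.comp hk hcs
  have h₂ : Primrec fun x : ℕ × NFACode × List NFACode =>
      liftCode x.1 (x.2.1 :: x.2.2) x.2.1 := by
    have h := primrec_liftCode.comp hx hc
    exact h
  have h₃ : Primrec fun x : ℕ × NFACode × List NFACode =>
      x.2.2.map (liftCode x.1 (x.2.1 :: x.2.2)) := by
    have h := primrec_liftCode.comp (hx.comp (Primrec.fst (β := NFACode))) Primrec.snd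
    exact Primrec.list_map hl h
  unfold coveringReduction
  exact h₁.pair (h₂.pair h₃)

theorem primrec_separationReduction : Primrec separationReduction := by
  have hk : Primrec fun x : ℕ × NFACode × NFACode => x.1 := Primrec.fst
  have hc : Primrec fun x : ℕ × NFACode × NFACode => x.2.1 := Primrec.fst.comp Primrec.snd
  have hd : Primrec fun x : ℕ × NFACode × NFACode => x.2.2 := Primrec.snd.comp Primrec.snd
  have hcs : Primrec fun x : ℕ × NFACode × NFACode => [x.2.1, x.2.2] :=
    Primrec.list_cons.comp hc (Primrec.list_cons.comp hd (Primrec.const []))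
  have hx := hk.pair hcs
  have h₁ : Primrec fun x : ℕ × NFACode × NFACode => newSize x.1 [x.2.1, x.2.2] :=
    primrec_newSize.comp hk hcs
  have h₂ : Primrec fun x : ℕ × NFACode × NFACode => liftCode x.1 [x.2.1, x.2.2] x.2.1 := by
    have h := primrec_liftCode.comp hx hc
    exact h
  have h₃ : Primrec fun x : ℕ × NFACode × NFACode => liftCode x.1 [x.2.1, x.2.2] x.2.2 := by
    have h := primrec_liftCode.comp hx hd
    exact h
  unfold separationReduction
  exact h₁.pair (h₂.pair h₃)

end Computability

/-! ### The reductions are correct -/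

section Final

variable {C : LanguageClass}

theorem commonEnd_iff (k : ℕ) (c : NFACode) (cs : List NFACode) (q v : List (Fin (k + 1))) :
    commonEnd (exponent (c :: cs)) (c.language k)
      (Multiset.ofList (cs.map fun c : NFACode => c.language k)) q v ↔
      ∀ c' ∈ c :: cs, HasEnd (exponent (c :: cs)) (c'.language k) q v := by
  rw [commonEnd, List.forall_mem_cons]
  refine and_congr_right fun _ => ⟨fun h c' hc' => h _ (List.mem_map_of_mem hc'), fun h L hL => ?_⟩
  obtain ⟨c', hc', rfl⟩ := List.mem_map.1 (Multiset.mem_coe.1 hL)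
  exact h c' hc'

theorem coveringProblem_iff (hC : IsPositiveVariety C) (x : ℕ × NFACode × List NFACode) :
    CoveringProblem (enrich (enrich C SU) MOD) x ↔ CoveringProblem C (coveringReduction x) := by
  obtain ⟨k, c, l⟩ := x
  set cs := c :: l with hcs
  have hG := commonEnd_iff k c l
  have hrec : ∀ c' ∈ cs, Recognizes (transLetter (bound cs) cs) (c'.language k) := fun c' hc' =>
    recognizes_language (length_le_bound cs) (fun c hc => statesLT_bound hc) hc'
  have hrecs : ∀ L ∈ Multiset.ofList (l.map fun c : NFACode => c.language k),
      Recognizes (transLetter (bound cs) cs) L := by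
    intro L hL
    obtain ⟨c', hc', rfl⟩ := List.mem_map.1 (Multiset.mem_coe.1 hL)
    exact hrec c' (List.mem_cons_of_mem _ hc')
  have hnew : CoveringProblem C (coveringReduction (k, c, l)) ↔
      Coverable C (lift (exponent cs) (newLetter (newSize k cs)) (tailBound cs)
        (commonEnd (exponent cs) (c.language k)
          (Multiset.ofList (l.map fun c : NFACode => c.language k))) (c.language k))
      ((Multiset.ofList (l.map fun c : NFACode => c.language k)).map
        (lift (exponent cs) (newLetter (newSize k cs)) (tailBound cs)
          (commonEnd (exponent cs) (c.language k)
            (Multiset.ofList (l.map fun c : NFACode => c.language k))))) := by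
    change Coverable C ((liftCode k cs c).language (newSize k cs)) (Multiset.ofList
      ((l.map (liftCode k cs)).map fun c : NFACode => c.language (newSize k cs))) ↔ _
    have h : (l.map (liftCode k cs)).map (fun c : NFACode => c.language (newSize k cs)) =
        (l.map fun c : NFACode => c.language k).map
          (lift (exponent cs) (newLetter (newSize k cs)) (tailBound cs)
            (commonEnd (exponent cs) (c.language k)
              (Multiset.ofList (l.map fun c : NFACode => c.language k)))) := by
      rw [List.map_map, List.map_map]
      exact List.map_congr_left fun c' hc' => language_liftCode hG (List.mem_cons_of_mem c hc')
    rw [language_liftCode hG List.mem_cons_self, Multiset.map_coe, h]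
  rw [hnew]
  exact ⟨lift_coverable hC (isStable_exponent cs) (newLetter_injOn hG)
      (hrec c List.mem_cons_self) hrecs,
    coverable_of_lift hC (isStable_exponent cs) (card_mul_exponent cs)
      (hrec c List.mem_cons_self) hrecs⟩

theorem separationProblem_iff (hC : IsPositiveVariety C) (x : ℕ × NFACode × NFACode) :
    SeparationProblem (enrich (enrich C SU) MOD) x ↔
      SeparationProblem C (separationReduction x) := by
  obtain ⟨k, c, c'⟩ := x
  set cs := [c, c'] with hcs
  have hG := commonEnd_iff k c [c']
  have hrec : ∀ d ∈ cs, Recognizes (transLetter (bound cs) cs) (d.language k) := fun d hd =>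
    recognizes_language (length_le_bound cs) (fun c hc => statesLT_bound hc) hd
  have hmem : c' ∈ cs := by simp [hcs]
  have h1 := language_liftCode hG (c := c) List.mem_cons_self
  have h2 := language_liftCode hG (c := c') hmem
  change Separable _ (c.language k) (c'.language k) ↔ Separable C
    ((liftCode k cs c).language (newSize k cs)) ((liftCode k cs c').language (newSize k cs))
  rw [h1, h2]
  constructor
  · intro h
    exact (lift_coverable hC (isStable_exponent cs) (newLetter_injOn hG)
      (hrec c List.mem_cons_self) (by simpa using hrec c' hmem) h.coverable).separable hC
  · exact separable_of_lift hC (isStable_exponent cs) (card_mul_exponent cs)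
      (hrec c List.mem_cons_self) (hrec c' hmem)

end Final

end WordLang

theorem corollary5p2 (C : WordLang.LanguageClass) (hC : WordLang.IsPositiveVariety C) :
    ManyOneReducible
        (WordLang.CoveringProblem (WordLang.enrich (WordLang.enrich C WordLang.SU) WordLang.MOD))
        (WordLang.CoveringProblem C) ∧
      ManyOneReducible
        (WordLang.SeparationProblem (WordLang.enrich (WordLang.enrich C WordLang.SU) WordLang.MOD))
        (WordLang.SeparationProblem C) :=
  ⟨⟨WordLang.coveringReduction, WordLang.primrec_coveringReduction.to_comp,
      WordLang.coveringProblem_iff hC⟩,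
    ⟨WordLang.separationReduction, WordLang.primrec_separationReduction.to_comp,
      WordLang.separationProblem_iff hC⟩⟩
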